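/- **Setting.** Let $\Sigma_\varphi=\{z\in\mathbb C\setminus\{0\}:|\arg z|<\varphi\}$. Let $A$ be a linear operator with domain $D(A)$ in a complex Banach space $X$ such that for every $\varphi\in(\pi/2,\pi)$ there is $c_\varphi$ with: for all $z\in\Sigma_\varphi$, $z-A$ has a bounded inverse and $$\|(z-A)^{-1}\|\le c_\varphi|z|^{-1}. \tag{1}$$ Let $1\le k\le 6$, $0<\alpha<1$, $T>0$, $N\ge 1$, $\tau=T/N$, $t_n=n\tau$, and $$\delta(\zeta)=\sum_{j=1}^k\tfrac1j(1-\zeta)^j,\quad \delta_\tau(\zeta)=\tau^{-1}\delta(\zeta),\quad \delta(\zeta)^\alpha=\sum_{j\ge0}b_j\zeta^j,\quad \bar\partial_\tau^\alpha\varphi^n=\tau^{-\alpha}\sum_{j=0}^n b_j\varphi^{n-j},$$ with principal powers. Let $a_j^{(k)},b_{\ell,j}^{(k)}$ ($1\le j\le k-1$, $1\le\ell\le k-2$) be arbitrary numbers, $v\in D(A)$, and $f:[0,T]\to X$ be of class $C^{\max(k-2,0)}$ near $t=0$. Let $U^0=v$ and let $U^1,\dots,U^N\in D(A)$ solve the corrected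 scheme $$\bar\partial_\tau^\alpha(U-v)^n-AU^n=a_n^{(k)}(Av+f(0))+f(t_n)+\sum_{\ell=1}^{k-2}b_{\ell,n}^{(k)}\tau^\ell\partial_t^\ell f(0)\quad(1\le n\le \min(k-1,N)),$$ $$\bar\partial_\tau^\alpha(U-v)^n-AU^n=f(t_n)\quad(k\le n\le N).$$ Put $K(z)=z^{-1}(z^\alpha-A)^{-1}$, $\gamma_\ell(\zeta)=\big(\zeta\frac{d}{d\zeta}\big)^\ell\frac1{1-\zeta}$, and $$\mu(\zeta)=\delta(\zeta)\Big(\frac{\zeta}{1-\zeta}+\sum_{j=1}^{k-1}a_j^{(k)}\zeta^j\Big),\qquad R_k(t)=f(t)-f(0)-\sum_{\ell=1}^{k-2}\frac{t^\ell}{\ell!}\partial_t^\ell f(0).$$ For $\theta\in(\pi/2,\pi)$ and $0<\delta<\pi/\tau$ let $\Gamma^\tau_{\theta,\delta}$ be the part in $|\mathrm{Im}\,z|\le\pi/\tau$ of $\{|z|=\delta,|\arg z|\le\theta\}\cup\{\rho e^{\pm i\theta}:\rho\ge\delta\}$, oriented with increasing imaginary part. Let $\widetilde R_k(\zeta)=\sum_{n\ge1}r_n\zeta^n$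 near $\zeta=0$, where $r_n=R_k(t_n)$ for $1\le n\le N$ and the $r_n\in X$ with $n>N$ are arbitrary, subject only to this: the series converges near $0$ and its sum $\widetilde R_k$ extends holomorphically to a neighbourhood of $$\{0\}\cup\{e^{-z\tau}:|z|\ge\delta,\ |\arg z|\le\theta,\ |\mathrm{Im}\,z|\le\pi/\tau\}.$$ (For instance $r_n=0$ for $n>N$, in which case $\widetilde R_k$ is a polynomial.) **Theorem.** For each $k$ there is $\theta_0\in(\pi/2,\pi]$, depending only on $k$, such that for all data as above, all $\theta\in(\pi/2,\theta_0)$ and all $0<\delta<\pi/\tau$: for $z\in\Gamma^\tau_{\theta,\delta}$ we have $\delta_\tau(e^{-z\tau})\notin(-\infty,0]$, the operator $\delta_\tau(e^{-z\tau})^\alpha-A$ has a bounded inverse, the map $z\mapsto K(\delta_\tau(e^{-z\tau}))$ is norm-continuous on $\Gamma^\tau_{\theta,\delta}$, and for $1\le n\le N$ the discrete solution $W^n=U^n-v$ is $$\begin{aligned}W^n&=\frac1{2\pi i}\int_{\Gamma^\tau_{\theta,\delta}}e^{zt_n}\mu(e^{-z\tau})K(\delta_\tau(e^{-z\tau}))(Av+f(0))\,dz\\&+\frac1{2\pi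 i}\int_{\Gamma^\tau_{\theta,\delta}}e^{zt_n}\delta_\tau(e^{-z\tau})K(\delta_\tau(e^{-z\tau}))\sum_{\ell=1}^{k-2}\Big(\frac{\gamma_\ell(e^{-z\tau})}{\ell!}+\sum_{j=1}^{k-1}b_{\ell,j}^{(k)}e^{-zt_j}\Big)\tau^{\ell+1}\partial_t^\ell f(0)\,dz\\&+\frac1{2\pi i}\int_{\Gamma^\tau_{\theta,\delta}}e^{zt_n}\delta_\tau(e^{-z\tau})K(\delta_\tau(e^{-z\tau}))\,\tau\widetilde R_k(e^{-z\tau})\,dz.\end{aligned}$$ Moreover (1) holds, so the representation applies, for the Dirichlet Laplacian on $X=L^2(\Omega;\mathbb C)$, for every open $\Omega\subset\mathbb R^d$ (domain: those $u\in H^1_0(\Omega)$ with $\Delta u\in L^2(\Omega)$), and for its Galerkin approximation $\Delta_h$ on every finite-dimensional subspace $X=V_h\subset H^1_0(\Omega)$ with the $L^2$ norm, $(\Delta_hu,\chi)=-(\nabla u,\nabla\chi)$ for all $u,\chi\in V_h$. -/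

import Mathlib

open MeasureTheory Set Filter Topology
open scoped ContDiff InnerProductSpace

universe u

noncomputable section

namespace BDFSub

/-! ### Unbounded operators and the resolvent estimate -/

section Resolvent

variable {X : Type*} [NormedAddCommGroup X] [NormedSpace ℂ X]

/-- `R` is a bounded everywhere defined two-sided inverse of `z - A`. -/
def IsResolventAt (A : X →ₗ.[ℂ] X) (z : ℂ) (R : X →L[ℂ] X) : Prop :=
  (∀ x : X, ∃ y : A.domain, (y : X) = R x ∧ z • (y : X) - A y = x) ∧
    ∀ y : A.domain, R (z • (y : X) - A y) = y

/-- The resolvent set of `A`. -/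
def resolventSet (A : X →ₗ.[ℂ] X) : Set ℂ := {z | ∃ R : X →L[ℂ] X, IsResolventAt A z R}

theorem IsResolventAt.unique {A : X →ₗ.[ℂ] X} {z : ℂ} {R S : X →L[ℂ] X}
    (hR : IsResolventAt A z R) (hS : IsResolventAt A z S) : R = S := by
  ext x
  obtain ⟨y, hy, hx⟩ := hR.1 x
  rw [← hy, ← hS.2 y, hx]

open Classical in
/-- The resolvent `(z - A)⁻¹` (with the value `0` off the resolvent set). -/
def resolvent (A : X →ₗ.[ℂ] X) (z : ℂ) : X →L[ℂ] X :=
  if h : ∃ R : X →L[ℂ] X, IsResolventAt A z R then h.choose else 0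

theorem IsResolventAt.resolvent_eq {A : X →ₗ.[ℂ] X} {z : ℂ} {R : X →L[ℂ] X}
    (hR : IsResolventAt A z R) : resolvent A z = R := by
  have h : ∃ R : X →L[ℂ] X, IsResolventAt A z R := ⟨R, hR⟩
  rw [resolvent, dif_pos h]
  exact h.choose_spec.unique hR

/-- The resolvent estimate: for every angle `φ ∈ (π/2, π)` there is a constant `c` such that
`‖(z - A)⁻¹‖ ≤ c |z|⁻¹` on the sector `{z ≠ 0 : |arg z| < φ}`. -/
def ResolventEstimate (A : X →ₗ.[ℂ] X) : Prop :=
  ∀ φ : ℝ, Real.pi / 2 < φ → φ < Real.pi → ∃ c : ℝ, ∀ z : ℂ, z ≠ 0 → |z.arg| < φ →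
    z ∈ resolventSet A ∧ ‖resolvent A z‖ ≤ c * ‖z‖⁻¹

end Resolvent

/-! ### The Dirichlet Laplacian and its Galerkin approximations -/

section Laplacian

variable {d : ℕ}

/-- The complex Hilbert space `L²(Ω)`. -/
abbrev L2 (Ω : Set (EuclideanSpace ℝ (Fin d))) : Type :=
  Lp ℂ 2 ((volume : Measure (EuclideanSpace ℝ (Fin d))).restrict Ω)

/-- The pairs `(φ, ∇φ)`, as elements of `L²(Ω) × L²(Ω)^d`, with `φ` smooth and compactly supported
in `Ω`. -/
def testGraph (Ω : Set (EuclideanSpace ℝ (Fin d))) : Set (L2 Ω × (Fin d → L2 Ω)) :=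
  {q | ∃ φ : EuclideanSpace ℝ (Fin d) → ℂ, ContDiff ℝ ∞ φ ∧ HasCompactSupport φ ∧ tsupport φ ⊆ Ω ∧
    q.1 =ᵐ[volume.restrict Ω] φ ∧
    ∀ i, q.2 i =ᵐ[volume.restrict Ω] fun x => fderiv ℝ φ x (EuclideanSpace.single i 1)}

/-- The pairs `(u, ∇u)` with `u ∈ H¹₀(Ω)`: the closure of the pairs `(φ, ∇φ)` of test functions
in `L²(Ω) × L²(Ω)^d`. (The test pairs already form a linear subspace.) -/
def sobolevGraph (Ω : Set (EuclideanSpace ℝ (Fin d))) : Submodule ℂ (L2 Ω × (Fin d → L2 Ω)) :=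
  (Submodule.span ℂ (testGraph Ω)).topologicalClosure

/-- `(∇u, ∇χ) = -(w, χ)` for all `χ ∈ V ∩ H¹₀(Ω)`, where `u ∈ H¹₀(Ω)`. -/
def IsWeakLaplacian (Ω : Set (EuclideanSpace ℝ (Fin d))) (V : Submodule ℂ (L2 Ω))
    (u w : L2 Ω) : Prop :=
  ∃ p : Fin d → L2 Ω, (u, p) ∈ sobolevGraph Ω ∧
    ∀ (χ : L2 Ω) (q : Fin d → L2 Ω), χ ∈ V → (χ, q) ∈ sobolevGraph Ω →
      ∑ i, ⟪q i, p i⟫_ℂ = -⟪χ, w⟫_ℂ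

theorem IsWeakLaplacian.zero {Ω : Set (EuclideanSpace ℝ (Fin d))} {V : Submodule ℂ (L2 Ω)} :
    IsWeakLaplacian Ω V 0 0 :=
  ⟨0, (sobolevGraph Ω).zero_mem, fun χ q _ _ => by simp⟩

theorem IsWeakLaplacian.add {Ω : Set (EuclideanSpace ℝ (Fin d))} {V : Submodule ℂ (L2 Ω)}
    {u w u' w' : L2 Ω} (h : IsWeakLaplacian Ω V u w) (h' : IsWeakLaplacian Ω V u' w') :
    IsWeakLaplacian Ω V (u + u') (w + w') := by
  obtain ⟨p, hp, hpw⟩ := h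
  obtain ⟨p', hp', hpw'⟩ := h'
  refine ⟨p + p', (sobolevGraph Ω).add_mem hp hp', fun χ q hχ hq => ?_⟩
  simp only [Pi.add_apply, inner_add_right, Finset.sum_add_distrib, hpw χ q hχ hq,
    hpw' χ q hχ hq, neg_add]

theorem IsWeakLaplacian.smul {Ω : Set (EuclideanSpace ℝ (Fin d))} {V : Submodule ℂ (L2 Ω)}
    {u w : L2 Ω} (c : ℂ) (h : IsWeakLaplacian Ω V u w) :
    IsWeakLaplacian Ω V (c • u) (c • w) := by
  obtain ⟨p, hp, hpw⟩ := h
  refine ⟨c • p, (sobolevGraph Ω).smul_mem c hp, fun χ q hχ hq => ?_⟩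
  simp only [Pi.smul_apply, inner_smul_right, ← Finset.mul_sum, hpw χ q hχ hq, mul_neg]

theorem IsWeakLaplacian.inner_eq_zero {Ω : Set (EuclideanSpace ℝ (Fin d))}
    {V : Submodule ℂ (L2 Ω)} {w : L2 Ω} (h : IsWeakLaplacian Ω V 0 w) {χ : L2 Ω}
    {q : Fin d → L2 Ω} (hχ : χ ∈ V) (hq : (χ, q) ∈ sobolevGraph Ω) : ⟪χ, w⟫_ℂ = 0 := by
  obtain ⟨p, hp, hpw⟩ := h
  have h0 : ∑ i, ⟪p i, p i⟫_ℂ = 0 := by simpa using hpw 0 p V.zero_mem hp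
  have h1 : ∑ i, ‖p i‖ ^ 2 = 0 := by
    have : ((∑ i, ‖p i‖ ^ 2 : ℝ) : ℂ) = 0 := by
      rw [← h0]
      push_cast
      exact Finset.sum_congr rfl fun i _ => (inner_self_eq_norm_sq_to_K (𝕜 := ℂ) (p i)).symm
    exact_mod_cast this
  have h2 : ∀ i, p i = 0 := fun i => by
    have := (Finset.sum_eq_zero_iff_of_nonneg (fun i _ => sq_nonneg ‖p i‖)).1 h1 i
      (Finset.mem_univ i)
    simpa using this
  have := hpw χ q hχ hq
  simp only [h2, inner_zero_right, Finset.sum_const_zero] at this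
  exact neg_eq_zero.1 this.symm

/-- The graph of the Dirichlet Laplacian. -/
def dirichletGraph (Ω : Set (EuclideanSpace ℝ (Fin d))) : Submodule ℂ (L2 Ω × L2 Ω) where
  carrier := {x | IsWeakLaplacian Ω ⊤ x.1 x.2}
  zero_mem' := IsWeakLaplacian.zero
  add_mem' h h' := IsWeakLaplacian.add h h'
  smul_mem' c _ h := IsWeakLaplacian.smul c h

/-- The Laplacian with homogeneous Dirichlet boundary condition, as an unbounded operator in
`L²(Ω)`: its domain consists of the `u ∈ H¹₀(Ω)` for which there is `w ∈ L²(Ω)` with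
`(∇u, ∇χ) = -(w, χ)` for all `χ ∈ H¹₀(Ω)`, and it maps `u` to `w`. -/
def dirichletLaplacian (Ω : Set (EuclideanSpace ℝ (Fin d))) : L2 Ω →ₗ.[ℂ] L2 Ω :=
  (dirichletGraph Ω).toLinearPMap

/-- The graph of the discrete Laplacian on a Galerkin space `V`. -/
def galerkinGraph (Ω : Set (EuclideanSpace ℝ (Fin d))) (V : Submodule ℂ (L2 Ω)) :
    Submodule ℂ (V × V) where
  carrier := {x | IsWeakLaplacian Ω V x.1 x.2}
  zero_mem' := IsWeakLaplacian.zero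
  add_mem' h h' := IsWeakLaplacian.add h h'
  smul_mem' c _ h := IsWeakLaplacian.smul c h

/-- The discrete Laplacian `Δ_h` on a Galerkin space `V ⊆ H¹₀(Ω)`, with the `L²` norm on `V`:
`(Δ_h u, χ) = -(∇u, ∇χ)` for all `u, χ ∈ V`. -/
def galerkinLaplacian (Ω : Set (EuclideanSpace ℝ (Fin d))) (V : Submodule ℂ (L2 Ω)) :
    V →ₗ.[ℂ] V :=
  (galerkinGraph Ω V).toLinearPMap

theorem mem_graph_galerkinLaplacian {Ω : Set (EuclideanSpace ℝ (Fin d))} {V : Submodule ℂ (L2 Ω)}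
    (hV : ∀ u ∈ V, ∃ p : Fin d → L2 Ω, (u, p) ∈ sobolevGraph Ω) (u w : V) :
    (u, w) ∈ (galerkinLaplacian Ω V).graph ↔ IsWeakLaplacian Ω V u w := by
  rw [galerkinLaplacian, Submodule.toLinearPMap_graph_eq]
  · rfl
  · rintro ⟨u, w⟩ h rfl
    obtain ⟨q, hq⟩ := hV w w.2
    have := IsWeakLaplacian.inner_eq_zero (w := (w : L2 Ω)) h w.2 hq
    exact Subtype.ext (inner_self_eq_zero.1 this)

theorem mem_graph_dirichletLaplacian {Ω : Set (EuclideanSpace ℝ (Fin d))} (hΩ : IsOpen Ω)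
    (u w : L2 Ω) :
    (u, w) ∈ (dirichletLaplacian Ω).graph ↔ IsWeakLaplacian Ω ⊤ u w := by
  rw [dirichletLaplacian, Submodule.toLinearPMap_graph_eq]
  · rfl
  · rintro ⟨u, w⟩ h rfl
    change w = 0
    have hw : ∀ᵐ x ∂(volume : Measure (EuclideanSpace ℝ (Fin d))), x ∈ Ω → w x = 0 := by
      have hloc : LocallyIntegrableOn w Ω (volume : Measure (EuclideanSpace ℝ (Fin d))) :=
        (locallyIntegrableOn_of_locallyIntegrable_restrict
          ((Lp.memLp w).locallyIntegrable (by norm_num)))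
      refine hΩ.ae_eq_zero_of_integral_contDiff_smul_eq_zero hloc fun g hg hgc hgs => ?_
      have hG : ContDiff ℝ ∞ fun x => (g x : ℂ) := Complex.ofRealCLM.contDiff.comp hg
      have hGc : HasCompactSupport fun x => (g x : ℂ) := hgc.comp_left (g := ((↑) : ℝ → ℂ)) rfl
      have hGs : tsupport (fun x => (g x : ℂ)) ⊆ Ω :=
        (closure_mono (fun x hx => by
          simp only [Function.mem_support, ne_eq, Complex.ofReal_eq_zero] at hx ⊢
          exact hx)).trans hgs
      have hm : MemLp (fun x => (g x : ℂ)) 2 (volume.restrict Ω) :=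
        (hG.continuous.memLp_of_hasCompactSupport hGc).restrict Ω
      have hm' : ∀ i : Fin d, MemLp (fun x => fderiv ℝ (fun x => (g x : ℂ)) x
          (EuclideanSpace.single i 1)) 2 (volume.restrict Ω) := fun i => by
        refine (Continuous.memLp_of_hasCompactSupport ?_ ?_).restrict Ω
        · exact (hG.continuous_fderiv (by simp)).clm_apply continuous_const
        · exact hGc.fderiv_apply (𝕜 := ℝ) _
      have key := IsWeakLaplacian.inner_eq_zero (χ := hm.toLp _) (q := fun i => (hm' i).toLp _) h
        trivial (Submodule.le_topologicalClosure _ (Submodule.subset_span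
          ⟨_, hG, hGc, hGs, hm.coeFn_toLp, fun i => (hm' i).coeFn_toLp⟩))
      rw [L2.inner_def] at key
      have h3 : ∫ x in Ω, g x • w x = 0 := by
        rw [← key]
        refine integral_congr_ae ?_
        filter_upwards [hm.coeFn_toLp] with x hx
        rw [hx]
        simp [mul_comm]
      rw [← h3]
      refine (setIntegral_eq_integral_of_forall_compl_eq_zero fun x hx => ?_).symm
      have : g x = 0 := image_eq_zero_of_notMem_tsupport fun hx' => hx (hgs hx')
      simp [this]
    refine Lp.eq_zero_iff_ae_eq_zero.2 ?_
    exact (ae_restrict_iff' hΩ.measurableSet).2 hw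

end Laplacian

/-! ### The corrected BDF convolution quadrature -/

/-- `δ(ζ) = ∑_{j=1}^k (1 - ζ)^j / j`. -/
def bdf (k : ℕ) (ζ : ℂ) : ℂ := ∑ j ∈ Finset.Icc 1 k, (1 / (j : ℂ)) * (1 - ζ) ^ j

/-- `δ_τ(ζ) = δ(ζ) / τ`. -/
def bdfStep (k : ℕ) (τ : ℝ) (ζ : ℂ) : ℂ := (1 / (τ : ℂ)) * bdf k ζ

/-- The weights `b_j`: Taylor coefficients at `0` of `δ(ζ)^α = ∑ b_j ζ^j` (principal branch,
so that `b_0 = δ(0)^α > 0`). -/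
def cqWeight (k : ℕ) (α : ℝ) (j : ℕ) : ℂ :=
  iteratedDeriv j (fun ζ : ℂ => bdf k ζ ^ (α : ℂ)) 0 / (j.factorial : ℂ)

section Scheme

variable {X : Type*} [NormedAddCommGroup X] [NormedSpace ℂ X]

/-- The convolution quadrature `τ^{-α} ∑_{j=0}^n b_j φ^{n-j}`. -/
def cqDeriv (k : ℕ) (α τ : ℝ) (φ : ℕ → X) (n : ℕ) : X :=
  (((τ ^ α)⁻¹ : ℝ) : ℂ) • ∑ j ∈ Finset.range (n + 1), cqWeight k α j • φ (n - j)

/-- The derivative `∂_t^ℓ f(0)` of a function on `[0,T]` (one-sided at `0`). -/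
def derivAtZero (T : ℝ) (f : ℝ → X) (ℓ : ℕ) : X := iteratedDerivWithin ℓ f (Icc 0 T) 0

/-- The remainder `R_k(t) = f(t) - f(0) - ∑_{ℓ=1}^{k-2} t^ℓ/ℓ! ∂_t^ℓ f(0)`. -/
def remainder (k : ℕ) (T : ℝ) (f : ℝ → X) (t : ℝ) : X :=
  f t - f 0 - ∑ ℓ ∈ Finset.Icc 1 (k - 2), (t ^ ℓ / (ℓ.factorial : ℝ)) • derivAtZero T f ℓ

/-- `U^0 = v, U^1, …, U^N` solves the corrected scheme with correction coefficients `a n` and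
`b ℓ n`. The source enters through its values on `[0,T]`, `T = N τ`. -/
structure IsDiscreteSolution (k : ℕ) (α τ T : ℝ) (N : ℕ) (A : X →ₗ.[ℂ] X) (a : ℕ → ℂ)
    (b : ℕ → ℕ → ℂ) (v : A.domain) (f : ℝ → X) (U : ℕ → A.domain) : Prop where
  init : U 0 = v
  corrected : ∀ n, 1 ≤ n → n ≤ N → n < k →
    cqDeriv k α τ (fun m => (U m : X) - v) n - A (U n) =
      a n • (A v + f 0) + f (n * τ) +
        ∑ ℓ ∈ Finset.Icc 1 (k - 2), (b ℓ n * (τ : ℂ) ^ ℓ) • derivAtZero T f ℓ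
  standard : ∀ n, 1 ≤ n → n ≤ N → k ≤ n →
    cqDeriv k α τ (fun m => (U m : X) - v) n - A (U n) = f (n * τ)

/-! ### Kernels, contour and generating functions -/

/-- `K(z) = z⁻¹ (z^α - A)⁻¹`. -/
def kernel (A : X →ₗ.[ℂ] X) (α : ℝ) (z : ℂ) : X →L[ℂ] X := z⁻¹ • resolvent A (z ^ (α : ℂ))

/-- `μ(ζ) = δ(ζ) (ζ/(1-ζ) + ∑_{j=1}^{k-1} a_j ζ^j)`. -/
def muFn (k : ℕ) (a : ℕ → ℂ) (ζ : ℂ) : ℂ :=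
  bdf k ζ * (ζ / (1 - ζ) + ∑ j ∈ Finset.Icc 1 (k - 1), a j * ζ ^ j)

/-- `γ_ℓ = (ζ d/dζ)^ℓ (1-ζ)⁻¹`. -/
def gammaFn : ℕ → ℂ → ℂ
  | 0 => fun ζ => (1 - ζ)⁻¹
  | ℓ + 1 => fun ζ => ζ * deriv (gammaFn ℓ) ζ

/-- The contour `Γ^τ_{θ,δ}` as a point set. -/
def contour (θ δ τ : ℝ) : Set ℂ :=
  {z | ((‖z‖ = δ ∧ |z.arg| ≤ θ) ∨
      ∃ ρ : ℝ, δ ≤ ρ ∧ (z = ρ * Complex.exp (θ * Complex.I) ∨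
        z = ρ * Complex.exp (-(θ * Complex.I)))) ∧ |z.im| ≤ Real.pi / τ}

/-- The integral over `Γ^τ_{θ,δ}` (for `δ < π/τ`), oriented with increasing imaginary part:
along the lower ray from radius `π/(τ sin θ)` to `δ`, then along the arc `|z| = δ`, then along the
upper ray from radius `δ` to `π/(τ sin θ)`, where `|Im z| = π/τ`. -/
def contourIntegral (θ δ τ : ℝ) (g : ℂ → X) : X :=
  (∫ ρ in (Real.pi / (τ * Real.sin θ))..δ,
      Complex.exp (-(θ * Complex.I)) • g (ρ * Complex.exp (-(θ * Complex.I)))) +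
    (∫ ψ in (-θ)..θ,
      (δ * Complex.exp (ψ * Complex.I) * Complex.I) • g (δ * Complex.exp (ψ * Complex.I))) +
    ∫ ρ in δ..(Real.pi / (τ * Real.sin θ)),
      Complex.exp (θ * Complex.I) • g (ρ * Complex.exp (θ * Complex.I))

/-- The image under `z ↦ e^{-zτ}` of the part of the strip `|Im z| ≤ π/τ` on or to the right of
the contour, with the limit point `ζ = 0`. -/
def zetaRegion (θ δ τ : ℝ) : Set ℂ :=
  insert 0 {ζ | ∃ z : ℂ, δ ≤ ‖z‖ ∧ |z.arg| ≤ θ ∧ |z.im| ≤ Real.pi / τ ∧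
    ζ = Complex.exp (-(z * τ))}

/-- `G` is the generating function `∑_{n ≥ 1} r_n ζ^n` of the sequence `(r_n)`, continued
analytically from a neighbourhood of `0` to a neighbourhood of `D`. -/
structure IsGeneratingFunction (r : ℕ → X) (D : Set ℂ) (G : ℂ → X) : Prop where
  hasSum : ∀ᶠ ζ in 𝓝 (0 : ℂ), HasSum (fun n : ℕ => ζ ^ (n + 1) • r (n + 1)) (G ζ)
  analytic : AnalyticOnNhd ℂ G D

/-- If the sequence vanishes beyond `N`, its generating function is a polynomial. -/
theorem isGeneratingFunction_of_finite {r : ℕ → X} {N : ℕ} (hr : ∀ n, N < n → r n = 0)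
    (D : Set ℂ) :
    IsGeneratingFunction r D fun ζ => ∑ n ∈ Finset.range N, ζ ^ (n + 1) • r (n + 1) where
  hasSum := Eventually.of_forall fun ζ => hasSum_sum_of_ne_finset_zero fun n hn => by
    rw [hr (n + 1) (by simpa [Nat.lt_succ_iff] using hn), smul_zero]
  analytic := fun z _ => Finset.analyticAt_fun_sum _ fun n _ =>
    (analyticAt_id.pow (n + 1)).smul analyticAt_const

end Scheme

end BDFSub

end

namespace BDFSub

/-! Substitute `ζ = e^{-zτ}`. The contour integral, divided by `2πi/τ`, then reads off Taylor
coefficients at `ζ = 0`, and the three integrands together come from `τ (δ_τ(ζ)^α - A)⁻¹ F(ζ)`,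
where `F` is the generating function of the right-hand side of the scheme for `W = U - v`; the
factor `δ_τ` cancels the `z⁻¹` in `K`.

Reading off coefficients rests on three facts. The integrand is analytic in the strip `|Im z| ≤ π/τ`
on and to the right of the contour; it has period `2πi/τ`; and after a Taylor polynomial in `ζ` is
subtracted it tends to zero as `Re z → ∞`. Cauchy's theorem then removes the remainder
(`contourIntegral_eq_zero`), and the polynomial is integrated exactly by primitives
(`contourIntegral_exp`).

Analyticity needs `δ(e^{-w}) ∉ (-∞,0]` somewhat to the left of the imaginary axis as well. On the
closed unit disc minus the point 1 this is an algebraic check on the circle followed by an open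
mapping argument; a Taylor estimate at `w = 0` and compactness elsewhere extend it to a set `Re w ≥
-c |Im w|`, with `c` depending only on `k`, which gives `θ₀`. As `0 < α < 1`, the power `δ_τ^α`
remains in the slit plane, which the resolvent estimate places in the resolvent set.

The scheme says only that the coefficients of `(δ_τ^α - A) ∑ W^n ζ^n` and of `F` agree up to order
`N`. No solution beyond `N` is needed: for the polynomial `∑_{n ≤ N} W^n ζ^n` the two sides agree up
to `O(ζ^{N+1})`, and applying the resolvent, bounded near `ζ = 0`, preserves this
(`isBigO_resolvent_sub`).

For the Laplacians, nonpositivity of `⟪u, Au⟫` bounds the resolvent wherever it exists, Riesz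
representation makes `1 - A` surjective, and connectedness of the slit plane carries invertibility
from 1 to all of it. -/

/-! ### The BDF symbol avoids the negative real axis -/

theorem differentiable_bdf (k : ℕ) : Differentiable ℂ (bdf k) := by
  unfold bdf
  fun_prop

theorem bdf_one (k : ℕ) : bdf k 1 = 0 := by
  refine Finset.sum_eq_zero fun j hj => ?_
  have : j ≠ 0 := by have := (Finset.mem_Icc.1 hj).1; omega
  simp [this]

theorem bdf_ofReal_re_pos {k : ℕ} (hk : 1 ≤ k) {x : ℝ} (hx : x < 1) : 0 < (bdf k x).re := by
  have h : bdf k x = ((∑ j ∈ Finset.Icc 1 k, (1 / (j : ℝ)) * (1 - x) ^ j : ℝ) : ℂ) := by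
    simp [bdf]
  rw [h, Complex.ofReal_re]
  refine Finset.sum_pos (fun j hj => ?_) ⟨1, Finset.mem_Icc.2 ⟨le_rfl, hk⟩⟩
  have : 0 < j := (Finset.mem_Icc.1 hj).1
  have : 0 < 1 - x := by linarith
  positivity

/-- On the unit circle `s = 1 - ζ` is a root of a quadratic with real coefficients, so `δ(ζ) = p + q
s` with `p, q` real polynomials in `u = Re s`. For each `k ≤ 6` the polynomial `q` is positive on
`[0,2]`, hence `Im δ(ζ) = -q Im ζ` vanishes only for real `ζ`. -/
theorem bdf_mem_slitPlane_of_norm_eq_one {k : ℕ} (hk : 1 ≤ k) (hk6 : k ≤ 6) {ζ : ℂ}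
    (h1 : ‖ζ‖ = 1) (hζ : ζ ≠ 1) : bdf k ζ ∈ Complex.slitPlane := by
  have hn : ζ.re ^ 2 + ζ.im ^ 2 = 1 := by
    have := Complex.sq_norm ζ
    rw [Complex.normSq_apply, h1] at this
    linarith
  by_cases hy : ζ.im = 0
  · have hr : ζ = (ζ.re : ℂ) := Complex.ext rfl (by simp [hy])
    have hlt : ζ.re < 1 := by
      refine lt_of_le_of_ne (by nlinarith) fun h => hζ ?_
      rw [hr, h, Complex.ofReal_one]
    rw [hr]
    exact Or.inl (bdf_ofReal_re_pos hk hlt)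
  · refine Or.inr ?_
    set u : ℝ := 1 - ζ.re with hu
    have hu0 : 0 ≤ u := by nlinarith [sq_nonneg ζ.im]
    have hu2 : u ≤ 2 := by nlinarith [sq_nonneg ζ.im]
    set s : ℂ := 1 - ζ with hs
    -- The equation `s² - 2 (Re s) s + |s|² = 0`, where `|1 - s| = 1` gives `|s|² = 2u`.
    have h2 : s ^ 2 = 2 * u * (s - 1) := by
      apply Complex.ext
      · simp [pow_two, hs, hu]; linarith
      · simp [pow_two, hs, hu]; ring
    have h3 : s ^ 3 = 2 * u * (s ^ 2 - s) := by linear_combination s * h2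
    have h4 : s ^ 4 = 2 * u * (s ^ 3 - s ^ 2) := by linear_combination s ^ 2 * h2
    have h5 : s ^ 5 = 2 * u * (s ^ 4 - s ^ 3) := by linear_combination s ^ 3 * h2
    have h6 : s ^ 6 = 2 * u * (s ^ 5 - s ^ 4) := by linear_combination s ^ 4 * h2
    have key : ∃ p q : ℝ, 0 < q ∧ bdf k ζ = p + q * s := by
      have hbdf : bdf k ζ = ∑ j ∈ Finset.Icc 1 k, (1 / (j : ℂ)) * s ^ j := rfl
      have e2 : s ^ 2 = ((-2 * u : ℝ) : ℂ) + ((2 * u : ℝ) : ℂ) * s := by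
        rw [h2]; push_cast; ring
      have e3 : s ^ 3 = ((-4 * u ^ 2 : ℝ) : ℂ) + ((4 * u ^ 2 - 2 * u : ℝ) : ℂ) * s := by
        rw [h3, e2]; push_cast; ring
      have e4 : s ^ 4 = ((-8 * u ^ 3 + 4 * u ^ 2 : ℝ) : ℂ) +
          ((8 * u ^ 3 - 8 * u ^ 2 : ℝ) : ℂ) * s := by
        rw [h4, e3, e2]; push_cast; ring
      have e5 : s ^ 5 = ((-16 * u ^ 4 + 16 * u ^ 3 : ℝ) : ℂ) +
          ((16 * u ^ 4 - 24 * u ^ 3 + 4 * u ^ 2 : ℝ) : ℂ) * s := by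
        rw [h5, e4, e3]; push_cast; ring
      have e6 : s ^ 6 = ((-32 * u ^ 5 + 48 * u ^ 4 - 8 * u ^ 3 : ℝ) : ℂ) +
          ((32 * u ^ 5 - 64 * u ^ 4 + 24 * u ^ 3 : ℝ) : ℂ) * s := by
        rw [h6, e5, e4]; push_cast; ring
      rw [hbdf]
      interval_cases k
      · exact ⟨0, 1, one_pos, by simp⟩
      · refine ⟨-u, 1 + u, by positivity, ?_⟩
        simp [Finset.sum_Icc_succ_top]
        rw [e2]; push_cast; ring
      · refine ⟨-u - 4 / 3 * u ^ 2, 1 + u / 3 + 4 / 3 * u ^ 2, by positivity, ?_⟩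
        simp [Finset.sum_Icc_succ_top]
        rw [e3, e2]; push_cast; ring
      · refine ⟨-u - 1 / 3 * u ^ 2 - 2 * u ^ 3, 1 + u / 3 - 2 / 3 * u ^ 2 + 2 * u ^ 3, ?_, ?_⟩
        · nlinarith [mul_nonneg hu0 (sq_nonneg (u - 1 / 3))]
        simp [Finset.sum_Icc_succ_top]
        rw [e4, e3, e2]; push_cast; ring
      · refine ⟨-u - 1 / 3 * u ^ 2 + 6 / 5 * u ^ 3 - 16 / 5 * u ^ 4,
          1 + u / 3 + 2 / 15 * u ^ 2 - 14 / 5 * u ^ 3 + 16 / 5 * u ^ 4, ?_, ?_⟩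
        · nlinarith [sq_nonneg (u ^ 2 - 7 / 16 * u), sq_nonneg (u - 1 / 2)]
        simp [Finset.sum_Icc_succ_top]
        rw [e5, e4, e3, e2]; push_cast; ring
      · refine ⟨-u - 1 / 3 * u ^ 2 - 2 / 15 * u ^ 3 + 24 / 5 * u ^ 4 - 16 / 3 * u ^ 5,
          1 + u / 3 + 2 / 15 * u ^ 2 + 6 / 5 * u ^ 3 - 112 / 15 * u ^ 4 + 16 / 3 * u ^ 5, ?_, ?_⟩
        · nlinarith [mul_nonneg hu0 (sq_nonneg (u ^ 2 - 4 / 5 * u)),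
            mul_nonneg hu0 (sq_nonneg (u ^ 2 - 1)), mul_nonneg hu0 (sq_nonneg (u - 1)),
            sq_nonneg (u - 1), sq_nonneg (u ^ 2 - u)]
        simp [Finset.sum_Icc_succ_top]
        rw [e6, e5, e4, e3, e2]; push_cast; ring
    obtain ⟨p, q, hq, he⟩ := key
    rw [he]
    simp [hs, hq.ne', hy]

theorem isOpenMap_bdf {k : ℕ} (hk : 1 ≤ k) : IsOpenMap (bdf k) := by
  refine (AnalyticOnNhd.is_constant_or_isOpenMap
    (Complex.analyticOnNhd_univ_iff_differentiable.2 (differentiable_bdf k))).resolve_left ?_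
  rintro ⟨w, hw⟩
  have h := bdf_ofReal_re_pos hk (x := 0) one_pos
  rw [Complex.ofReal_zero, hw, ← hw 1, bdf_one] at h
  exact lt_irrefl _ h

/-- Minimise `Re δ` over the points of the closed disc where `δ` is real. Since `δ` is an open map,
a minimiser cannot be interior; on the circle a nonpositive minimum can only occur at 1, where `δ =
0`. Every other point with real `δ` therefore has `δ > 0`. -/
theorem bdf_mem_slitPlane_of_norm_le_one {k : ℕ} (hk : 1 ≤ k) (hk6 : k ≤ 6) {ζ : ℂ}
    (h1 : ‖ζ‖ ≤ 1) (hζ : ζ ≠ 1) : bdf k ζ ∈ Complex.slitPlane := by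
  by_contra hmem
  have hcont : Continuous (bdf k) := (differentiable_bdf k).continuous
  rw [Complex.mem_slitPlane_iff, not_or, not_lt, not_not] at hmem
  have hC : IsCompact (Metric.closedBall (0 : ℂ) 1 ∩ {ξ | (bdf k ξ).im = 0}) :=
    (isCompact_closedBall 0 1).inter_right
      (isClosed_eq (Complex.continuous_im.comp hcont) continuous_const)
  obtain ⟨ξ, ⟨hξ1, hξ0⟩, hmin⟩ := hC.exists_isMinOn
    ⟨ζ, mem_closedBall_zero_iff.2 h1, hmem.2⟩ (Complex.continuous_re.comp hcont).continuousOn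
  have hmin' : ∀ η : ℂ, ‖η‖ ≤ 1 → (bdf k η).im = 0 → (bdf k ξ).re ≤ (bdf k η).re :=
    fun η h h' => hmin ⟨mem_closedBall_zero_iff.2 h, h'⟩
  -- From an interior point the value can be moved to the left along the real axis while its
  -- preimage stays in the disc.
  have hint : ∀ η : ℂ, ‖η‖ < 1 → (bdf k η).im = 0 → (bdf k ξ).re < (bdf k η).re := by
    intro η hη hη0
    have ho := isOpenMap_bdf hk _ (Metric.isOpen_ball (x := (0 : ℂ)) (ε := 1))
    obtain ⟨ε, hε, hsub⟩ := Metric.isOpen_iff.1 ho _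
      (mem_image_of_mem (bdf k) (mem_ball_zero_iff.2 hη))
    obtain ⟨η', hη', he⟩ := hsub (show bdf k η - ((ε / 2 : ℝ) : ℂ) ∈ Metric.ball (bdf k η) ε by
      rw [mem_ball_iff_norm, sub_sub_cancel_left, norm_neg, Complex.norm_real, Real.norm_eq_abs,
        abs_of_pos (by positivity)]
      linarith)
    have h := hmin' η' (mem_ball_zero_iff.1 hη').le (by rw [he]; simp [hη0])
    rw [he] at h
    simp at h
    linarith
  have hξ1' : ‖ξ‖ ≤ 1 := mem_closedBall_zero_iff.1 hξ1
  rcases hξ1'.lt_or_eq with hlt | heq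
  · exact lt_irrefl _ (hint ξ hlt hξ0)
  · have hle : (bdf k ξ).re ≤ (bdf k ζ).re := hmin' ζ h1 hmem.2
    have hξ : ξ = 1 := by
      by_contra hne
      rcases bdf_mem_slitPlane_of_norm_eq_one hk hk6 heq hne with h | h
      · linarith [hmem.1]
      · exact h hξ0
    rcases h1.lt_or_eq with hlt | heq'
    · have := hint ζ hlt hmem.2
      rw [hξ, bdf_one] at this
      simp at this
      linarith [hmem.1]
    · rcases bdf_mem_slitPlane_of_norm_eq_one hk hk6 heq' hζ with h | h
      · linarith [hmem.1]
      · exact h hmem.2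

theorem hasDerivAt_bdf_exp_neg {k : ℕ} (hk : 1 ≤ k) :
    HasDerivAt (fun w : ℂ => bdf k (Complex.exp (-w))) 1 0 := by
  have h1 : HasDerivAt (bdf k) (-1) (Complex.exp (-0)) := by
    have : HasDerivAt (bdf k) (∑ j ∈ Finset.Icc 1 k,
        (1 / (j : ℂ)) * (j * (1 - Complex.exp (-0)) ^ (j - 1) * (0 - 1))) (Complex.exp (-0)) := by
      unfold bdf
      refine HasDerivAt.fun_sum fun j _ => HasDerivAt.const_mul _ ?_
      exact ((hasDerivAt_const _ _).sub (hasDerivAt_id _)).pow j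
    convert this using 1
    rw [Finset.sum_eq_single 1]
    · simp
    · intro j hj hj1
      have : j - 1 ≠ 0 := by have := (Finset.mem_Icc.1 hj).1; omega
      simp [this]
    · intro h
      exact absurd (Finset.mem_Icc.2 ⟨le_rfl, hk⟩) h
  have h2 : HasDerivAt (fun w : ℂ => Complex.exp (-w)) (-1) 0 := by
    simpa using (hasDerivAt_neg (0 : ℂ)).cexp
  have h := h1.comp (0 : ℂ) h2
  rw [neg_mul_neg, one_mul] at h
  exact h

/-- The right half strip maps into the unit disc. To its left, `δ(e^{-w}) = w + o(w)` settles a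
neighbourhood of 0, and away from 0 the compact part of the imaginary axis has a tube around it on
which the open condition persists. -/
theorem exists_bdf_exp_neg_mem_slitPlane {k : ℕ} (hk : 1 ≤ k) (hk6 : k ≤ 6) :
    ∃ c : ℝ, 0 < c ∧ ∀ w : ℂ, w ≠ 0 → |w.im| ≤ Real.pi → -(c * |w.im|) ≤ w.re →
      bdf k (Complex.exp (-w)) ∈ Complex.slitPlane := by
  have hpi := Real.pi_pos
  have hcont : Continuous fun w : ℂ => bdf k (Complex.exp (-w)) :=
    (differentiable_bdf k).continuous.comp (by fun_prop)
  -- With `|δ(e^{-w}) - w| ≤ |w|/4`, a value in `(-∞,0]` would force both `|Re w|` and `|Im w|` to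
  -- be at most `|w|/4`, too small for `w ≠ 0`.
  obtain ⟨r, hr, hnear⟩ : ∃ r > 0, ∀ w : ℂ, w ≠ 0 → ‖w‖ < r → -|w.im| ≤ w.re →
      bdf k (Complex.exp (-w)) ∈ Complex.slitPlane := by
    have h := (hasDerivAt_iff_isLittleO.1 (hasDerivAt_bdf_exp_neg hk)).def
      (show (0 : ℝ) < 1 / 4 by norm_num)
    obtain ⟨r, hr, h⟩ := Metric.eventually_nhds_iff.1 h
    refine ⟨r, hr, fun w hw0 hw hre => ?_⟩
    have h' := h (show dist w 0 < r by simpa using hw)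
    simp only [neg_zero, Complex.exp_zero, bdf_one, sub_zero, smul_eq_mul, mul_one] at h'
    by_contra hn
    rw [Complex.mem_slitPlane_iff, not_or, not_lt, not_not] at hn
    have h1 := (Complex.abs_re_le_norm _).trans h'
    have h2 := (Complex.abs_im_le_norm _).trans h'
    simp only [Complex.sub_re, Complex.sub_im, hn.2, zero_sub, abs_neg] at h1 h2
    have h3 := Complex.norm_le_abs_re_add_abs_im w
    have h4 : |w.re| ≤ 1 / 4 * ‖w‖ := by
      rw [abs_le] at h1 ⊢
      constructor <;> linarith [h1.1, h1.2, hn.1]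
    have : 0 < ‖w‖ := norm_pos_iff.2 hw0
    linarith
  set K : Set ℂ := (fun y : ℝ => (y : ℂ) * Complex.I) '' {y : ℝ | r / 2 ≤ |y| ∧ |y| ≤ Real.pi}
  have hK : IsCompact K := by
    refine IsCompact.image ?_ (by fun_prop)
    refine Metric.isCompact_of_isClosed_isBounded ?_ ?_
    · exact (isClosed_le continuous_const continuous_abs).inter
        (isClosed_le continuous_abs continuous_const)
    · refine (Metric.isBounded_closedBall (x := (0 : ℝ)) (r := Real.pi)).subset fun y hy => ?_
      simpa using hy.2
  have hright : ∀ w : ℂ, w ≠ 0 → |w.im| ≤ Real.pi → 0 ≤ w.re →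
      bdf k (Complex.exp (-w)) ∈ Complex.slitPlane := by
    intro w hw0 him hre
    refine bdf_mem_slitPlane_of_norm_le_one hk hk6 ?_ fun h => hw0 ?_
    · rw [Complex.norm_exp, Complex.neg_re]
      exact Real.exp_le_one_iff.2 (by linarith)
    · obtain ⟨n, hn⟩ := Complex.exp_eq_one_iff.1 h
      have h1 := congrArg Complex.re hn
      have h2 := congrArg Complex.im hn
      simp at h1 h2
      -- The strip has height `2π`, but `|Im w| ≤ π` leaves no room for a nonzero multiple of `2π`.
      have h3 : n = 0 := by
        by_contra hne
        have : (1 : ℝ) ≤ |(n : ℝ)| := by exact_mod_cast Int.one_le_abs hne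
        have h4 : |w.im| = |(n : ℝ)| * (2 * Real.pi) := by
          rw [← abs_neg, h2, abs_mul, abs_of_pos (by positivity : 0 < 2 * Real.pi)]
        nlinarith
      exact Complex.ext h1 (by simpa [h3] using h2)
  have hKU : K ⊆ (fun w : ℂ => bdf k (Complex.exp (-w))) ⁻¹' Complex.slitPlane := by
    rintro _ ⟨y, ⟨hy1, hy2⟩, rfl⟩
    refine hright _ ?_ (by simpa using hy2) (by simp)
    rintro h
    have : y = 0 := by simpa using h
    rw [this, abs_zero] at hy1
    linarith
  obtain ⟨ε, hε, hsub⟩ := hK.exists_thickening_subset_open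
    (Complex.isOpen_slitPlane.preimage hcont) hKU
  -- The bound 1 serves the cone near 0, and also gives `|Im w| ≥ r/2` once `|w| ≥ r` and `Re w <
  -- 0`. The bound `ε/4` keeps `w` within `ε` of the imaginary axis, as `π < 4`.
  refine ⟨min 1 (ε / 4), by positivity, fun w hw0 him hre => ?_⟩
  have hc1 : min 1 (ε / 4) * |w.im| ≤ |w.im| := by
    nlinarith [abs_nonneg w.im, min_le_left 1 (ε / 4)]
  have hc2 : min 1 (ε / 4) * |w.im| ≤ ε / 4 * |w.im| :=
    mul_le_mul_of_nonneg_right (min_le_right _ _) (abs_nonneg _)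
  rcases le_or_gt 0 w.re with h0 | h0
  · exact hright w hw0 him h0
  rcases lt_or_ge ‖w‖ r with hlt | hge
  · exact hnear w hw0 hlt (by linarith)
  · refine hsub (Metric.mem_thickening_iff.2 ⟨w.im * Complex.I, ⟨w.im, ⟨?_, him⟩, rfl⟩, ?_⟩)
    · have h3 := Complex.norm_le_abs_re_add_abs_im w
      rw [abs_of_neg h0] at h3
      linarith
    · have : w - w.im * Complex.I = (w.re : ℂ) := Complex.ext (by simp) (by simp)
      rw [dist_eq_norm, this, Complex.norm_real, Real.norm_eq_abs, abs_of_neg h0]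
      have : ε / 4 * |w.im| ≤ ε / 4 * Real.pi := by gcongr
      nlinarith [Real.pi_lt_four]

/-! ### Analyticity of the resolvent -/

section Resolvent

variable {X : Type*} [NormedAddCommGroup X] [NormedSpace ℂ X]

theorem resolvent_isResolventAt {A : X →ₗ.[ℂ] X} {z : ℂ} (hz : z ∈ resolventSet A) :
    IsResolventAt A z (resolvent A z) := by
  obtain ⟨R, hR⟩ := hz
  rwa [hR.resolvent_eq]

/-- On the domain, `z - A = (1 + (z - z₀) R)(z₀ - A)`. This form gives openness of the resolvent set
and analyticity at once. -/
theorem IsResolventAt.mul_inverse {A : X →ₗ.[ℂ] X} {z₀ z : ℂ} {R : X →L[ℂ] X}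
    (hR : IsResolventAt A z₀ R) (hu : IsUnit (1 + (z - z₀) • R)) :
    IsResolventAt A z (R * Ring.inverse (1 + (z - z₀) • R)) := by
  have h1 := Ring.mul_inverse_cancel _ hu
  have h2 := Ring.inverse_mul_cancel _ hu
  set S := Ring.inverse (1 + (z - z₀) • R)
  refine ⟨fun x => ?_, fun y => ?_⟩
  · obtain ⟨y, hy, hx⟩ := hR.1 (S x)
    refine ⟨y, hy, ?_⟩
    have h : S x + (z - z₀) • R (S x) = x := by simpa using congrArg (fun L : X →L[ℂ] X => L x) h1
    rw [← hy, ← hx] at h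
    refine Eq.trans ?_ h
    module
  · have h : S ((z₀ • (y : X) - A y) + (z - z₀) • R (z₀ • (y : X) - A y)) = z₀ • (y : X) - A y := by
      simpa using congrArg (fun L : X →L[ℂ] X => L (z₀ • (y : X) - A y)) h2
    rw [hR.2 y] at h
    have h' : z • (y : X) - A y = z₀ • (y : X) - A y + (z - z₀) • (y : X) := by module
    rw [mul_apply_eq_comp, h', h, hR.2 y]

theorem analyticAt_resolvent [CompleteSpace X] {A : X →ₗ.[ℂ] X} {z₀ : ℂ}
    (hz : z₀ ∈ resolventSet A) : AnalyticAt ℂ (resolvent A) z₀ := by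
  obtain ⟨R, hR⟩ := hz
  have hlin : AnalyticAt ℂ (fun z : ℂ => (1 : X →L[ℂ] X) + (z - z₀) • R) z₀ :=
    analyticAt_const.add ((analyticAt_id.sub analyticAt_const).smul analyticAt_const)
  have hinv : AnalyticAt ℂ (fun z : ℂ => R * Ring.inverse (1 + (z - z₀) • R)) z₀ := by
    refine analyticAt_const.mul (AnalyticAt.fun_comp (g := Ring.inverse) ?_ hlin)
    have := analyticAt_inverse (𝕜 := ℂ) (1 : (X →L[ℂ] X)ˣ)
    simpa using this
  refine hinv.congr ?_
  have hunit : ∀ᶠ z in 𝓝 z₀, IsUnit ((1 : X →L[ℂ] X) + (z - z₀) • R) :=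
    hlin.continuousAt.eventually (Units.isOpen.mem_nhds (by simp))
  filter_upwards [hunit] with z hz
  exact (hR.mul_inverse hz).resolvent_eq.symm

theorem ResolventEstimate.mem_resolventSet {A : X →ₗ.[ℂ] X} (hA : ResolventEstimate A) {z : ℂ}
    (hz : z ∈ Complex.slitPlane) : z ∈ resolventSet A := by
  have hpi := Real.pi_pos
  obtain ⟨harg, h0⟩ := Complex.mem_slitPlane_iff_arg.1 hz
  have hlt : |z.arg| < Real.pi :=
    lt_of_le_of_ne (Complex.abs_arg_le_pi z) fun h => by
      rcases abs_eq hpi.le |>.1 h with h | h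
      · exact harg h
      · exact (Complex.neg_pi_lt_arg z).ne' h
  obtain ⟨φ, h1, h2⟩ := exists_between (max_lt (half_lt_self hpi) hlt)
  obtain ⟨c, hc⟩ := hA φ ((le_max_left _ _).trans_lt h1) h2
  exact (hc z h0 ((le_max_right _ _).trans_lt h1)).1

end Resolvent

/-! ### Fractional powers and the angle `θ₀` -/

theorem cpow_mem_slitPlane {α : ℝ} (h0 : 0 < α) (h1 : α < 1) {z : ℂ}
    (hz : z ∈ Complex.slitPlane) : z ^ (α : ℂ) ∈ Complex.slitPlane := by
  have hpi := Real.pi_pos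
  obtain ⟨harg, hz0⟩ := Complex.mem_slitPlane_iff_arg.1 hz
  rw [Complex.cpow_def_of_ne_zero hz0, Complex.mem_slitPlane_iff_arg]
  refine ⟨?_, Complex.exp_ne_zero _⟩
  have him : (Complex.log z * α).im = z.arg * α := by simp [Complex.log_im]
  have h2 := Complex.neg_pi_lt_arg z
  have h3 := Complex.arg_le_pi z
  rw [Complex.arg_exp, him, toIocMod_eq_self _ |>.2]
  · nlinarith
  · constructor <;> nlinarith

theorem bdfStep_mem_slitPlane {k : ℕ} {τ : ℝ} (hτ : 0 < τ) {ζ : ℂ}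
    (h : bdf k ζ ∈ Complex.slitPlane) : bdfStep k τ ζ ∈ Complex.slitPlane := by
  have hb : bdfStep k τ ζ = ((1 / τ : ℝ) : ℂ) * bdf k ζ := by simp [bdfStep]
  have hτ' : 0 < 1 / τ := by positivity
  rw [hb]
  rcases h with h | h
  · left
    rw [Complex.re_ofReal_mul]
    positivity
  · right
    rw [Complex.im_ofReal_mul]
    exact mul_ne_zero hτ'.ne' h

/-- The sector of half-angle `π/2 + arctan c` is the set `Re z ≥ -c |Im z|`, which is invariant
under the scaling `w = zτ`; hence one angle serves all `τ`. -/
theorem exists_angle_bdfStep_mem_slitPlane {k : ℕ} (hk : 1 ≤ k) (hk6 : k ≤ 6) :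
    ∃ θ₀ : ℝ, Real.pi / 2 < θ₀ ∧ θ₀ ≤ Real.pi ∧ ∀ θ, θ < θ₀ → ∀ τ : ℝ, 0 < τ → ∀ z : ℂ, z ≠ 0 →
      |z.arg| ≤ θ → |z.im| ≤ Real.pi / τ →
      bdfStep k τ (Complex.exp (-(z * τ))) ∈ Complex.slitPlane := by
  obtain ⟨c, hc, h⟩ := exists_bdf_exp_neg_mem_slitPlane hk hk6
  have hat : 0 < Real.arctan c := Real.arctan_pos.2 hc
  have hat2 := Real.arctan_lt_pi_div_two c
  refine ⟨Real.pi / 2 + Real.arctan c, by linarith, by linarith, fun θ hθ τ hτ z hz harg him => ?_⟩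
  refine bdfStep_mem_slitPlane hτ (h _ (mul_ne_zero hz (by exact_mod_cast hτ.ne')) ?_ ?_)
  · rw [Complex.im_mul_ofReal, abs_mul, abs_of_pos hτ]
    exact (le_div_iff₀ hτ).1 him
  · have key : -(c * |z.im|) ≤ z.re := by
      have hre := Complex.norm_mul_cos_arg z
      have him' := Complex.norm_mul_sin_arg z
      rcases le_or_gt |z.arg| (Real.pi / 2) with h1 | h1
      · have := Complex.abs_arg_le_pi_div_two_iff.1 h1
        have := mul_nonneg hc.le (abs_nonneg z.im)
        linarith
      · have h2 : |z.im| = ‖z‖ * Real.sin |z.arg| := by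
          rw [← him', abs_mul, abs_norm,
            Real.abs_sin_eq_sin_abs_of_abs_le_pi (Complex.abs_arg_le_pi z)]
        rw [h2, ← hre, ← Real.cos_abs]
        have h3 : Real.tan (|z.arg| - Real.pi / 2) ≤ c := by
          rw [← Real.tan_arctan c]
          exact Real.strictMonoOn_tan.monotoneOn ⟨by linarith, by linarith⟩
            ⟨by linarith, by linarith⟩ (by linarith)
        have hs : 0 < Real.sin |z.arg| :=
          Real.sin_pos_of_pos_of_lt_pi (by linarith [Real.pi_pos]) (by linarith)
        rw [Real.tan_eq_sin_div_cos, Real.sin_sub_pi_div_two, Real.cos_sub_pi_div_two,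
          div_le_iff₀ hs] at h3
        nlinarith [norm_nonneg z]
    rw [Complex.im_mul_ofReal, Complex.re_mul_ofReal, abs_mul, abs_of_pos hτ]
    nlinarith

/-! ### Cauchy's theorem and the deformation of the contour -/

section Contour

variable {E : Type*} [NormedAddCommGroup E] [NormedSpace ℂ E]

/-- Cauchy's theorem on the image of a rectangle: the pullback of `h dz` under `H` is a closed form,
so the divergence theorem makes its boundary integral zero. -/
theorem integral_boundary_homotopy {h : ℂ → E} {H : ℝ × ℝ → ℂ} {a₁ b₁ a₂ b₂ : ℝ}
    (hH : ∀ p ∈ uIcc a₁ b₁ ×ˢ uIcc a₂ b₂, ContDiffAt ℝ 2 H p)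
    (hh : ∀ p ∈ uIcc a₁ b₁ ×ˢ uIcc a₂ b₂, AnalyticAt ℂ h (H p)) {Hs Ht : ℝ → ℝ → ℂ}
    (hs : ∀ s ∈ uIcc a₁ b₁, ∀ t ∈ uIcc a₂ b₂, HasDerivAt (fun s' => H (s', t)) (Hs s t) s)
    (ht : ∀ s ∈ uIcc a₁ b₁, ∀ t ∈ uIcc a₂ b₂, HasDerivAt (fun t' => H (s, t')) (Ht s t) t) :
    (∫ t in a₂..b₂, Ht b₁ t • h (H (b₁, t))) - ∫ t in a₂..b₂, Ht a₁ t • h (H (a₁, t)) =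
      (∫ s in a₁..b₁, Hs s b₂ • h (H (s, b₂))) - ∫ s in a₁..b₁, Hs s a₂ • h (H (s, a₂)) := by
  set D : Set (ℝ × ℝ) := uIcc a₁ b₁ ×ˢ uIcc a₂ b₂ with hD
  have hH1 : ∀ p ∈ D, HasFDerivAt H (fderiv ℝ H p) p := fun p hp =>
    ((hH p hp).differentiableAt (by norm_num)).hasFDerivAt
  have hH2 : ∀ p ∈ D, HasFDerivAt (fderiv ℝ H) (fderiv ℝ (fderiv ℝ H) p) p := fun p hp =>
    (((hH p hp).fderiv_right (m := 1) (by norm_num)).differentiableAt (by norm_num)).hasFDerivAt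
  have hform : ∀ (e : ℝ × ℝ), ∀ p ∈ D, HasFDerivAt (fun p => fderiv ℝ H p e • h (H p))
      ((fderiv ℝ H p e) • ((ContinuousLinearMap.toSpanSingleton ℂ
        (deriv h (H p))).restrictScalars ℝ).comp (fderiv ℝ H p) +
        (((ContinuousLinearMap.apply ℝ ℂ e).comp (fderiv ℝ (fderiv ℝ H) p))).smulRight
          (h (H p))) p := by
    intro e p hp
    have e1 : HasFDerivAt (fun p => fderiv ℝ H p e)
        ((ContinuousLinearMap.apply ℝ ℂ e).comp (fderiv ℝ (fderiv ℝ H) p)) p :=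
      (ContinuousLinearMap.apply ℝ ℂ e).hasFDerivAt.comp p (hH2 p hp)
    have e2 : HasFDerivAt (fun p => h (H p))
        (((ContinuousLinearMap.toSpanSingleton ℂ
          (deriv h (H p))).restrictScalars ℝ).comp (fderiv ℝ H p)) p :=
      (((hh p hp).differentiableAt.hasDerivAt.hasFDerivAt).restrictScalars ℝ).comp p (hH1 p hp)
    exact e1.smul e2
  have hint : Ioo (min a₁ b₁) (max a₁ b₁) ×ˢ Ioo (min a₂ b₂) (max a₂ b₂) ⊆ D :=
    Set.prod_mono Ioo_subset_Icc_self Ioo_subset_Icc_self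
  -- Closedness: the terms with `h'` cancel because complex multiplication commutes, those with
  -- second derivatives of `H` by symmetry.
  have hzero : ∀ p ∈ D, ((fderiv ℝ H p (0, 1)) • ((ContinuousLinearMap.toSpanSingleton ℂ
        (deriv h (H p))).restrictScalars ℝ).comp (fderiv ℝ H p) +
        (((ContinuousLinearMap.apply ℝ ℂ (0, 1)).comp (fderiv ℝ (fderiv ℝ H) p))).smulRight
          (h (H p))) (1, 0) + (-((fderiv ℝ H p (1, 0)) • ((ContinuousLinearMap.toSpanSingleton ℂ
        (deriv h (H p))).restrictScalars ℝ).comp (fderiv ℝ H p) +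
        (((ContinuousLinearMap.apply ℝ ℂ (1, 0)).comp (fderiv ℝ (fderiv ℝ H) p))).smulRight
          (h (H p)))) (0, 1) = 0 := by
    intro p hp
    have hsymm := ((hH p hp).isSymmSndFDerivAt (by simp)).eq (1, 0) (0, 1)
    simp [hsymm, smul_smul, mul_comm]
  have hdiv := integral2_divergence_prod_of_hasFDerivAt
    (fun p => fderiv ℝ H p (0, 1) • h (H p)) (fun p => -(fderiv ℝ H p (1, 0) • h (H p)))
    _ _ a₁ a₂ b₁ b₂
    (fun p hp => (hform (0, 1) p hp).continuousAt.continuousWithinAt)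
    (fun p hp => (hform (1, 0) p hp).neg.continuousAt.continuousWithinAt)
    (fun p hp => hform (0, 1) p (hint hp)) (fun p hp => (hform (1, 0) p (hint hp)).neg)
    ((integrableOn_zero).congr_fun (fun p hp => (hzero p hp).symm)
      (measurableSet_uIcc.prod measurableSet_uIcc))
  rw [intervalIntegral.integral_congr (g := fun _ => (0 : E))] at hdiv
  swap
  · intro s hs'
    dsimp only
    rw [intervalIntegral.integral_congr (g := fun _ => (0 : E)), intervalIntegral.integral_zero]
    exact fun t ht' => hzero (s, t) ⟨hs', ht'⟩
  have es : ∀ s ∈ uIcc a₁ b₁, ∀ t ∈ uIcc a₂ b₂, fderiv ℝ H (s, t) (1, 0) = Hs s t := by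
    intro s hs' t ht'
    refine HasDerivAt.unique ?_ (hs s hs' t ht')
    exact HasFDerivAt.comp_hasDerivAt (l := H) (f := fun s' => (s', t)) s (hH1 _ ⟨hs', ht'⟩)
      ((hasDerivAt_id s).prodMk (hasDerivAt_const s t))
  have et : ∀ s ∈ uIcc a₁ b₁, ∀ t ∈ uIcc a₂ b₂, fderiv ℝ H (s, t) (0, 1) = Ht s t := by
    intro s hs' t ht'
    refine HasDerivAt.unique ?_ (ht s hs' t ht')
    exact HasFDerivAt.comp_hasDerivAt (l := H) (f := fun t' => (s, t')) t (hH1 _ ⟨hs', ht'⟩)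
      ((hasDerivAt_const t s).prodMk (hasDerivAt_id t))
  have cs : ∀ t ∈ uIcc a₂ b₂, ∫ s in a₁..b₁, Hs s t • h (H (s, t)) =
      ∫ s in a₁..b₁, fderiv ℝ H (s, t) (1, 0) • h (H (s, t)) := fun t ht' =>
    intervalIntegral.integral_congr fun s hs' => by simp only [es s hs' t ht']
  have ct : ∀ s ∈ uIcc a₁ b₁, ∫ t in a₂..b₂, Ht s t • h (H (s, t)) =
      ∫ t in a₂..b₂, fderiv ℝ H (s, t) (0, 1) • h (H (s, t)) := fun s hs' =>
    intervalIntegral.integral_congr fun t ht' => by simp only [et s hs' t ht']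
  rw [cs _ left_mem_uIcc, cs _ right_mem_uIcc, ct _ left_mem_uIcc, ct _ right_mem_uIcc]
  simp only [intervalIntegral.integral_zero, intervalIntegral.integral_neg] at hdiv
  rw [← sub_eq_zero]
  rw [hdiv]
  abel

end Contour

section Contour

variable {E : Type*} [NormedAddCommGroup E] [NormedSpace ℂ E]

/-- The part of the strip `|Im z| ≤ P` on or to the right of the contour. -/
def sectorStrip (θ δ P : ℝ) : Set ℂ := {z | δ ≤ ‖z‖ ∧ |z.arg| ≤ θ ∧ |z.im| ≤ P}

theorem arg_polar {r x : ℝ} (hr : 0 < r) (hx : |x| < Real.pi) :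
    ((r : ℂ) * Complex.exp ((x : ℝ) * Complex.I)).arg = x := by
  rw [Complex.exp_mul_I]
  exact Complex.arg_mul_cos_add_sin_mul_I hr ⟨(abs_lt.1 hx).1, (abs_lt.1 hx).2.le⟩

theorem norm_polar {r : ℝ} (hr : 0 ≤ r) (x : ℝ) :
    ‖(r : ℂ) * Complex.exp ((x : ℝ) * Complex.I)‖ = r := by
  rw [norm_mul, Complex.norm_exp_ofReal_mul_I, mul_one, Complex.norm_real, Real.norm_eq_abs,
    abs_of_nonneg hr]

theorem im_polar (r x : ℝ) :
    ((r : ℂ) * Complex.exp ((x : ℝ) * Complex.I)).im = r * Real.sin x := by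
  rw [Complex.im_ofReal_mul, Complex.exp_ofReal_mul_I_im]

theorem polar_mem_sectorStrip {θ δ P r x : ℝ} (hδ : 0 < δ) (hθ : θ < Real.pi) (hr : δ ≤ r)
    (hx : |x| ≤ θ) (hP : r * |Real.sin x| ≤ P) :
    (r : ℂ) * Complex.exp ((x : ℝ) * Complex.I) ∈ sectorStrip θ δ P := by
  have hr0 : 0 < r := hδ.trans_le hr
  refine ⟨by rwa [norm_polar hr0.le], by rwa [arg_polar hr0 (hx.trans_lt hθ)], ?_⟩
  rwa [im_polar, abs_mul, abs_of_pos hr0]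

/-- Cauchy's theorem on the piece of the strip between the imaginary axis and one ray, bounded by
the arc and by the line `Im z = σP`; `σ = ±1` selects the upper or lower piece. -/
theorem integral_sector {P δ θ σ : ℝ} (hσ : σ = 1 ∨ σ = -1) (hδ : 0 < δ) (hδP : δ < P)
    (hθ : Real.pi / 2 < θ) (hθ' : θ < Real.pi) {h : ℂ → E}
    (hh : ∀ z ∈ sectorStrip θ δ P, AnalyticAt ℂ h z) :
    (∫ ρ in δ..P / Real.sin θ, Complex.exp ((σ * θ : ℝ) * Complex.I) •
        h (ρ * Complex.exp ((σ * θ : ℝ) * Complex.I))) +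
      ∫ φ in (Real.pi / 2)..θ, (δ * Complex.exp ((σ * φ : ℝ) * Complex.I) * (σ * Complex.I)) •
        h (δ * Complex.exp ((σ * φ : ℝ) * Complex.I)) =
    (∫ φ in (Real.pi / 2)..θ, ((-(P / Real.sin φ ^ 2) : ℝ) : ℂ) •
        h ((P * Real.cos φ / Real.sin φ : ℝ) + (σ * P : ℝ) * Complex.I)) +
      ∫ s in (0 : ℝ)..1, (((P - δ : ℝ) : ℂ) * Complex.exp ((σ * (Real.pi / 2) : ℝ) * Complex.I)) •
        h ((δ + s * (P - δ) : ℝ) * Complex.exp ((σ * (Real.pi / 2) : ℝ) * Complex.I)) := by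
  have hpi := Real.pi_pos
  have hσ2 : σ * σ = 1 := by rcases hσ with rfl | rfl <;> norm_num
  have hσa : |σ| = 1 := by rcases hσ with rfl | rfl <;> norm_num
  have hsin : ∀ t ∈ uIcc (Real.pi / 2) θ, 0 < Real.sin t := fun t ht => by
    rw [uIcc_of_le hθ.le] at ht
    exact Real.sin_pos_of_pos_of_lt_pi (by linarith [ht.1]) (by linarith [ht.2])
  -- Polar angle `p.2`, radius moving linearly from `δ` to `P / sin p.2`, which lies on the line `Im
  -- z = σP`.
  set H : ℝ × ℝ → ℂ := fun p =>
    ((δ + p.1 * (P / Real.sin p.2 - δ) : ℝ) : ℂ) * Complex.exp ((σ * p.2 : ℝ) * Complex.I) with hHdef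
  have hmem : ∀ p ∈ uIcc (0 : ℝ) 1 ×ˢ uIcc (Real.pi / 2) θ, H p ∈ sectorStrip θ δ P := by
    rintro ⟨s, t⟩ ⟨hs, ht⟩
    have h1 := hsin t ht
    rw [uIcc_of_le zero_le_one] at hs
    rw [uIcc_of_le hθ.le] at ht
    have hs0 : 0 ≤ s := hs.1
    have hs1 : s ≤ 1 := hs.2
    have h2 : P ≤ P / Real.sin t := by
      rw [le_div_iff₀ h1]
      nlinarith [Real.sin_le_one t]
    refine polar_mem_sectorStrip hδ hθ' ?_ ?_ ?_
    · show δ ≤ δ + s * (P / Real.sin t - δ)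
      nlinarith
    · show |σ * t| ≤ θ
      rw [abs_mul, hσa, one_mul, abs_of_nonneg (by linarith [ht.1])]
      exact ht.2
    · show (δ + s * (P / Real.sin t - δ)) * |Real.sin (σ * t)| ≤ P
      have h3 : |Real.sin (σ * t)| = Real.sin t := by
        rcases hσ with rfl | rfl
        · rw [one_mul, abs_of_pos h1]
        · rw [neg_one_mul, Real.sin_neg, abs_neg, abs_of_pos h1]
      have h4 : P / Real.sin t * Real.sin t = P := div_mul_cancel₀ _ h1.ne'
      rw [h3]
      nlinarith [mul_nonneg (sub_nonneg.2 hs1) hδ.le, Real.sin_le_one t]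
  have key := integral_boundary_homotopy (h := h) (H := H) (a₁ := 0) (b₁ := 1)
    (a₂ := Real.pi / 2) (b₂ := θ)
    (Hs := fun _ t => ((P / Real.sin t - δ : ℝ) : ℂ) * Complex.exp ((σ * t : ℝ) * Complex.I))
    (Ht := fun s t => ((s * (-(P * Real.cos t) / Real.sin t ^ 2) : ℝ) : ℂ) *
        Complex.exp ((σ * t : ℝ) * Complex.I) +
      ((δ + s * (P / Real.sin t - δ) : ℝ) : ℂ) *
        (Complex.exp ((σ * t : ℝ) * Complex.I) * (σ * Complex.I)))
    ?_ (fun p hp => hh _ (hmem p hp)) ?_ ?_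
  · simp only [hHdef, zero_mul, add_zero, Complex.ofReal_zero, zero_add, one_mul,
      add_sub_cancel, Real.sin_pi_div_two, div_one] at key
    -- On the outer edge `z = P cot φ + iσP`, with derivative `-P / sin² φ`. This shape shows that
    -- the upper and lower edges differ by a period.
    have e1 : ∫ φ in (Real.pi / 2)..θ, ((-(P / Real.sin φ ^ 2) : ℝ) : ℂ) •
        h ((P * Real.cos φ / Real.sin φ : ℝ) + (σ * P : ℝ) * Complex.I) =
        ∫ t in Real.pi / 2..θ, (((-(P * Real.cos t) / Real.sin t ^ 2 : ℝ) : ℂ) *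
          Complex.exp ((σ * t : ℝ) * Complex.I) + ((P / Real.sin t : ℝ) : ℂ) *
          (Complex.exp ((σ * t : ℝ) * Complex.I) * (σ * Complex.I))) •
          h (((P / Real.sin t : ℝ) : ℂ) * Complex.exp ((σ * t : ℝ) * Complex.I)) := by
      refine intervalIntegral.integral_congr fun t ht => ?_
      have h1 : Real.sin t ≠ 0 := (hsin t ht).ne'
      have hexp : Complex.exp ((σ * t : ℝ) * Complex.I) =
          (Real.cos t : ℂ) + (Real.sin t : ℂ) * (σ * Complex.I) := by
        rw [Complex.exp_mul_I, ← Complex.ofReal_cos, ← Complex.ofReal_sin]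
        rcases hσ with rfl | rfl <;> simp
      have hsc : (Real.sin t : ℂ) ^ 2 + (Real.cos t : ℂ) ^ 2 = 1 := by
        exact_mod_cast Real.sin_sq_add_cos_sq t
      have h1' : (Real.sin t : ℂ) ≠ 0 := by exact_mod_cast h1
      have hσ2' : (σ : ℂ) ^ 2 = 1 := by exact_mod_cast (by rw [pow_two, hσ2] : σ ^ 2 = 1)
      have hI := Complex.I_sq
      congr 1
      · rw [hexp]
        push_cast [-Complex.ofReal_sin, -Complex.ofReal_cos]
        field_simp
        linear_combination (P : ℂ) * hsc - P * (Real.sin t : ℂ) ^ 2 * Complex.I ^ 2 * hσ2' -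
          P * (Real.sin t : ℂ) ^ 2 * hI
      · rw [hexp]
        congr 1
        push_cast [-Complex.ofReal_sin, -Complex.ofReal_cos]
        field_simp
    have e2 : ∫ ρ in δ..P / Real.sin θ, Complex.exp ((σ * θ : ℝ) * Complex.I) •
        h (ρ * Complex.exp ((σ * θ : ℝ) * Complex.I)) =
        ∫ s in (0 : ℝ)..1, (((P / Real.sin θ - δ : ℝ) : ℂ) *
          Complex.exp ((σ * θ : ℝ) * Complex.I)) •
          h (((δ + s * (P / Real.sin θ - δ) : ℝ) : ℂ) * Complex.exp ((σ * θ : ℝ) * Complex.I)) := by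
      have := intervalIntegral.smul_integral_comp_add_mul (a := 0) (b := 1)
        (fun ρ : ℝ => Complex.exp ((σ * θ : ℝ) * Complex.I) •
          h (ρ * Complex.exp ((σ * θ : ℝ) * Complex.I))) (P / Real.sin θ - δ) δ
      rw [mul_zero, add_zero, mul_one, add_sub_cancel] at this
      rw [← this, ← intervalIntegral.integral_smul]
      refine intervalIntegral.integral_congr fun s _ => ?_
      rw [← smul_assoc, Complex.real_smul, mul_comm s]
    have e3 : ∫ φ in (Real.pi / 2)..θ,
        (δ * Complex.exp ((σ * φ : ℝ) * Complex.I) * (σ * Complex.I)) •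
          h (δ * Complex.exp ((σ * φ : ℝ) * Complex.I)) =
        ∫ t in (Real.pi / 2)..θ,
          ((δ : ℂ) * (Complex.exp ((σ * t : ℝ) * Complex.I) * (σ * Complex.I))) •
          h (δ * Complex.exp ((σ * t : ℝ) * Complex.I)) := by
      simp only [mul_assoc]
    rw [e1, e2, e3, ← sub_eq_sub_iff_add_eq_add]
    exact key.symm
  · rintro ⟨s, t⟩ ⟨_, ht⟩
    have h1 : Real.sin t ≠ 0 := (hsin t ht).ne'
    have c1 : ContDiffAt ℝ 2 (fun p : ℝ × ℝ => δ + p.1 * (P / Real.sin p.2 - δ)) (s, t) := by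
      have : ContDiffAt ℝ 2 (fun p : ℝ × ℝ => P / Real.sin p.2) (s, t) :=
        contDiffAt_const.div (by fun_prop) h1
      exact contDiffAt_const.add (contDiffAt_fst.mul (this.sub contDiffAt_const))
    have c2 : ContDiffAt ℝ 2 (fun p : ℝ × ℝ => σ * p.2) (s, t) := by fun_prop
    have c3 := (Complex.ofRealCLM.contDiff (n := 2)).contDiffAt.comp (s, t) c1
    have c4 := (Complex.ofRealCLM.contDiff (n := 2)).contDiffAt.comp (s, t) c2
    exact c3.mul (c4.mul contDiffAt_const).cexp
  · intro s _ t _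
    have d1 : HasDerivAt (fun s' : ℝ => δ + s' * (P / Real.sin t - δ)) (P / Real.sin t - δ) s := by
      simpa using ((hasDerivAt_id s).mul_const (P / Real.sin t - δ)).const_add δ
    exact d1.ofReal_comp.mul_const (Complex.exp ((σ * t : ℝ) * Complex.I))
  · intro s _ t ht
    have h1 : Real.sin t ≠ 0 := (hsin t ht).ne'
    have d1 : HasDerivAt (fun t' : ℝ => δ + s * (P / Real.sin t' - δ))
        (s * (-(P * Real.cos t) / Real.sin t ^ 2)) t := by
      have := ((((hasDerivAt_const t P).div (Real.hasDerivAt_sin t) h1).sub_const δ).const_mul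
        s).const_add δ
      simpa using this
    have d2 : HasDerivAt (fun t' : ℝ => Complex.exp ((σ * t' : ℝ) * Complex.I))
        (Complex.exp ((σ * t : ℝ) * Complex.I) * (σ * Complex.I)) t := by
      have : HasDerivAt (fun t' : ℝ => σ * t') σ t := by
        simpa using (hasDerivAt_id t).const_mul σ
      exact (this.ofReal_comp.mul_const Complex.I).cexp
    exact d1.ofReal_comp.mul d2

theorem integral_half_annulus {P δ θ : ℝ} (hδ : 0 < δ) (hδP : δ < P)
    (hθ : Real.pi / 2 < θ) (hθ' : θ < Real.pi) {h : ℂ → E}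
    (hh : ∀ z ∈ sectorStrip θ δ P, AnalyticAt ℂ h z) :
    (∫ φ in (-(Real.pi / 2))..(Real.pi / 2),
        ((P : ℂ) * (Complex.exp ((φ : ℝ) * Complex.I) * Complex.I)) •
          h (P * Complex.exp ((φ : ℝ) * Complex.I))) -
      ∫ φ in (-(Real.pi / 2))..(Real.pi / 2),
        ((δ : ℂ) * (Complex.exp ((φ : ℝ) * Complex.I) * Complex.I)) •
          h (δ * Complex.exp ((φ : ℝ) * Complex.I)) =
    (∫ s in (0 : ℝ)..1, (((P - δ : ℝ) : ℂ) * Complex.exp ((Real.pi / 2 : ℝ) * Complex.I)) •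
        h ((δ + s * (P - δ) : ℝ) * Complex.exp ((Real.pi / 2 : ℝ) * Complex.I))) -
      ∫ s in (0 : ℝ)..1, (((P - δ : ℝ) : ℂ) * Complex.exp ((-(Real.pi / 2) : ℝ) * Complex.I)) •
        h ((δ + s * (P - δ) : ℝ) * Complex.exp ((-(Real.pi / 2) : ℝ) * Complex.I)) := by
  have hpi := Real.pi_pos
  have key := integral_boundary_homotopy (h := h) (H := fun p : ℝ × ℝ =>
      ((δ + p.1 * (P - δ) : ℝ) : ℂ) * Complex.exp ((p.2 : ℝ) * Complex.I)) (a₁ := 0) (b₁ := 1)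
    (a₂ := -(Real.pi / 2)) (b₂ := Real.pi / 2)
    (Hs := fun _ t => ((P - δ : ℝ) : ℂ) * Complex.exp ((t : ℝ) * Complex.I))
    (Ht := fun s t => ((δ + s * (P - δ) : ℝ) : ℂ) *
        (Complex.exp ((t : ℝ) * Complex.I) * Complex.I))
    ?_ ?_ ?_ ?_
  · simp only [zero_mul, add_zero, one_mul, add_sub_cancel] at key
    exact key
  · intro p _
    have c3 := (Complex.ofRealCLM.contDiff (n := 2)).contDiffAt.comp p
      (show ContDiffAt ℝ 2 (fun p : ℝ × ℝ => δ + p.1 * (P - δ)) p by fun_prop)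
    have c4 := (Complex.ofRealCLM.contDiff (n := 2)).contDiffAt.comp p
      (show ContDiffAt ℝ 2 (fun p : ℝ × ℝ => p.2) p by fun_prop)
    exact c3.mul (c4.mul contDiffAt_const).cexp
  · rintro ⟨s, t⟩ ⟨hs, ht⟩
    rw [uIcc_of_le zero_le_one] at hs
    rw [uIcc_of_le (by linarith)] at ht
    have hs0 : 0 ≤ s := hs.1
    have hs1 : s ≤ 1 := hs.2
    refine hh _ (polar_mem_sectorStrip hδ hθ' ?_ ?_ ?_)
    · show δ ≤ δ + s * (P - δ)
      nlinarith
    · exact (abs_le.2 ⟨ht.1, ht.2⟩).trans hθ.le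
    · show (δ + s * (P - δ)) * |Real.sin t| ≤ P
      have := Real.abs_sin_le_one t
      have : 0 ≤ δ + s * (P - δ) := by nlinarith
      nlinarith
  · intro s _ t _
    have d1 : HasDerivAt (fun s' : ℝ => δ + s' * (P - δ)) (P - δ) s := by
      simpa using ((hasDerivAt_id s).mul_const (P - δ)).const_add δ
    exact d1.ofReal_comp.mul_const (Complex.exp ((t : ℝ) * Complex.I))
  · intro s _ t _
    have d2 : HasDerivAt (fun t' : ℝ => Complex.exp ((t' : ℝ) * Complex.I))
        (Complex.exp ((t : ℝ) * Complex.I) * Complex.I) t := by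
      simpa using ((hasDerivAt_id t).ofReal_comp.mul_const Complex.I).cexp
    exact d2.const_mul ((δ + s * (P - δ) : ℝ) : ℂ)

/-- The end points `±iP` of the half circle sweep out horizontal segments one period apart, whose
contributions cancel. -/
theorem integral_translate_half_circle {P δ θ : ℝ} (hδ : 0 < δ) (hδP : δ < P)
    (hθ : Real.pi / 2 < θ) {h : ℂ → E}
    (hh : ∀ z ∈ sectorStrip θ δ P, AnalyticAt ℂ h z)
    (hper : ∀ x : ℝ, h (x + P * Complex.I) = h (x - P * Complex.I)) {C : ℝ} (hC : 0 ≤ C) :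
    (∫ φ in (-(Real.pi / 2))..(Real.pi / 2),
        ((P : ℂ) * (Complex.exp ((φ : ℝ) * Complex.I) * Complex.I)) •
          h (P * Complex.exp ((φ : ℝ) * Complex.I) + C)) =
      ∫ φ in (-(Real.pi / 2))..(Real.pi / 2),
        ((P : ℂ) * (Complex.exp ((φ : ℝ) * Complex.I) * Complex.I)) •
          h (P * Complex.exp ((φ : ℝ) * Complex.I)) := by
  have hpi := Real.pi_pos
  have hP : 0 < P := hδ.trans hδP
  have key := integral_boundary_homotopy (h := h) (H := fun p : ℝ × ℝ =>
      (P : ℂ) * Complex.exp ((p.2 : ℝ) * Complex.I) + (p.1 : ℝ)) (a₁ := 0) (b₁ := C)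
    (a₂ := -(Real.pi / 2)) (b₂ := Real.pi / 2)
    (Hs := fun _ _ => 1)
    (Ht := fun s t => (P : ℂ) * (Complex.exp ((t : ℝ) * Complex.I) * Complex.I))
    ?_ ?_ ?_ ?_
  · rw [← sub_eq_zero]
    simp only [Complex.ofReal_zero, add_zero] at key
    rw [key, sub_eq_zero]
    refine intervalIntegral.integral_congr fun s _ => ?_
    have e1 : Complex.exp ((Real.pi / 2 : ℝ) * Complex.I) = Complex.I := by
      push_cast; exact Complex.exp_pi_div_two_mul_I
    have e2 : Complex.exp ((-(Real.pi / 2) : ℝ) * Complex.I) = -Complex.I := by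
      push_cast; rw [← neg_div]; exact Complex.exp_neg_pi_div_two_mul_I
    rw [e1, e2, add_comm, hper, mul_neg, neg_add_eq_sub]
  · intro p _
    have c3 := (Complex.ofRealCLM.contDiff (n := 2)).contDiffAt.comp p
      (show ContDiffAt ℝ 2 (fun p : ℝ × ℝ => p.1) p by fun_prop)
    have c4 := (Complex.ofRealCLM.contDiff (n := 2)).contDiffAt.comp p
      (show ContDiffAt ℝ 2 (fun p : ℝ × ℝ => p.2) p by fun_prop)
    exact (contDiffAt_const.mul (c4.mul contDiffAt_const).cexp).add c3
  · rintro ⟨s, t⟩ ⟨hs, ht⟩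
    rw [uIcc_of_le hC] at hs
    rw [uIcc_of_le (by linarith)] at ht
    have hs0 : 0 ≤ s := hs.1
    have hcos : 0 ≤ Real.cos t := Real.cos_nonneg_of_mem_Icc ht
    have hre : ((P : ℂ) * Complex.exp ((t : ℝ) * Complex.I) + (s : ℝ)).re = P * Real.cos t + s := by
      rw [Complex.add_re, Complex.re_ofReal_mul, Complex.exp_ofReal_mul_I_re, Complex.ofReal_re]
    have him : ((P : ℂ) * Complex.exp ((t : ℝ) * Complex.I) + (s : ℝ)).im = P * Real.sin t := by
      rw [Complex.add_im, im_polar, Complex.ofReal_im, add_zero]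
    refine hh _ ⟨?_, ?_, ?_⟩
    · refine hδP.le.trans (le_of_sq_le_sq ?_ (norm_nonneg _))
      rw [Complex.sq_norm, Complex.normSq_apply]
      dsimp only
      rw [hre, him]
      nlinarith [Real.sin_sq_add_cos_sq t, mul_nonneg (mul_nonneg hP.le hcos) hs0]
    · refine le_trans (Complex.abs_arg_le_pi_div_two_iff.2 ?_) hθ.le
      dsimp only
      rw [hre]
      positivity
    · dsimp only
      rw [him, abs_mul, abs_of_pos hP]
      have := Real.abs_sin_le_one t
      nlinarith
  · intro s _ t _
    simpa using (hasDerivAt_id s).ofReal_comp.const_add ((P : ℂ) * Complex.exp ((t : ℝ) * Complex.I))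
  · intro s _ t _
    have d2 : HasDerivAt (fun t' : ℝ => Complex.exp ((t' : ℝ) * Complex.I))
        (Complex.exp ((t : ℝ) * Complex.I) * Complex.I) t := by
      simpa using ((hasDerivAt_id t).ofReal_comp.mul_const Complex.I).cexp
    exact (d2.const_mul (P : ℂ)).add_const ((s : ℝ) : ℂ)

end Contour

/-! ### Vanishing and orthogonality along the contour -/

section Contour

variable {E : Type*} [NormedAddCommGroup E] [NormedSpace ℂ E]

/-- Add the two sector identities and the half annulus identity: the segments on the imaginary axis
cancel in pairs, and the edges on `Im z = ±π/τ` cancel by periodicity. -/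
theorem contourIntegral_eq_half_circle {θ δ τ : ℝ} (hδ : 0 < δ)
    (hδP : δ < Real.pi / τ) (hθ : Real.pi / 2 < θ) (hθ' : θ < Real.pi) {h : ℂ → E}
    (hh : ∀ z ∈ sectorStrip θ δ (Real.pi / τ), AnalyticAt ℂ h z)
    (hper : ∀ x : ℝ, h (x + (Real.pi / τ : ℝ) * Complex.I) =
      h (x - (Real.pi / τ : ℝ) * Complex.I)) :
    contourIntegral θ δ τ h = ∫ φ in (-(Real.pi / 2))..(Real.pi / 2),
        (((Real.pi / τ : ℝ) : ℂ) * (Complex.exp ((φ : ℝ) * Complex.I) * Complex.I)) •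
          h ((Real.pi / τ : ℝ) * Complex.exp ((φ : ℝ) * Complex.I)) := by
  have hpi := Real.pi_pos
  set P : ℝ := Real.pi / τ with hP
  have hPs : Real.pi / (τ * Real.sin θ) = P / Real.sin θ := by rw [hP, div_div]
  have hup := integral_sector (Or.inl rfl) hδ hδP hθ hθ' hh
  have hlow := integral_sector (Or.inr rfl) hδ hδP hθ hθ' hh
  have hmid := integral_half_annulus hδ hδP hθ hθ' hh
  have hE1 : (∫ φ in (Real.pi / 2)..θ, ((-(P / Real.sin φ ^ 2) : ℝ) : ℂ) •
      h ((P * Real.cos φ / Real.sin φ : ℝ) + (1 * P : ℝ) * Complex.I)) =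
      ∫ φ in (Real.pi / 2)..θ, ((-(P / Real.sin φ ^ 2) : ℝ) : ℂ) •
        h ((P * Real.cos φ / Real.sin φ : ℝ) + (-1 * P : ℝ) * Complex.I) := by
    refine intervalIntegral.integral_congr fun φ _ => ?_
    have := hper (P * Real.cos φ / Real.sin φ)
    simp only [one_mul, neg_mul, Complex.ofReal_neg]
    rw [this, sub_eq_add_neg]
  set F : ℝ → E := fun ψ =>
    (δ * Complex.exp (ψ * Complex.I) * Complex.I) • h (δ * Complex.exp (ψ * Complex.I)) with hF
  have hFc : ContinuousOn F (Icc (-θ) θ) := by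
    intro ψ hψ
    have hmem : (δ : ℂ) * Complex.exp (ψ * Complex.I) ∈ sectorStrip θ δ P :=
      polar_mem_sectorStrip hδ hθ' le_rfl (abs_le.2 hψ) (by
        have := Real.abs_sin_le_one ψ
        nlinarith)
    have h1 : ContinuousAt (fun ψ : ℝ => (δ : ℂ) * Complex.exp (ψ * Complex.I)) ψ := by fun_prop
    have h2 : ContinuousAt (fun ψ : ℝ => h ((δ : ℂ) * Complex.exp (ψ * Complex.I))) ψ :=
      ContinuousAt.comp (f := fun ψ : ℝ => (δ : ℂ) * Complex.exp (ψ * Complex.I))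
        (hh _ hmem).continuousAt h1
    exact ((h1.mul continuousAt_const).smul h2).continuousWithinAt
  have hFi : ∀ a b : ℝ, a ∈ Icc (-θ) θ → b ∈ Icc (-θ) θ → IntervalIntegrable F volume a b :=
    fun a b ha hb => (hFc.mono (uIcc_subset_Icc ha hb)).intervalIntegrable
  have hsplit : ∫ ψ in (-θ)..θ, F ψ = (∫ ψ in (-θ)..(-(Real.pi / 2)), F ψ) +
      (∫ ψ in (-(Real.pi / 2))..(Real.pi / 2), F ψ) + ∫ ψ in (Real.pi / 2)..θ, F ψ := by
    rw [intervalIntegral.integral_add_adjacent_intervals,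
      intervalIntegral.integral_add_adjacent_intervals] <;>
    · refine hFi _ _ ?_ ?_ <;> constructor <;> linarith
  have hneg : ∫ ψ in (-θ)..(-(Real.pi / 2)), F ψ = -∫ φ in (Real.pi / 2)..θ,
      (δ * Complex.exp ((-1 * φ : ℝ) * Complex.I) * (((-1 : ℝ) : ℂ) * Complex.I)) •
        h (δ * Complex.exp ((-1 * φ : ℝ) * Complex.I)) := by
    rw [← intervalIntegral.integral_comp_neg, ← intervalIntegral.integral_neg]
    refine intervalIntegral.integral_congr fun φ _ => ?_
    simp only [hF, neg_one_mul, Complex.ofReal_neg, Complex.ofReal_one, mul_neg, neg_smul, neg_neg]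
  have hpos : ∫ φ in (Real.pi / 2)..θ,
      (δ * Complex.exp ((1 * φ : ℝ) * Complex.I) * (((1 : ℝ) : ℂ) * Complex.I)) •
        h (δ * Complex.exp ((1 * φ : ℝ) * Complex.I)) = ∫ φ in (Real.pi / 2)..θ, F φ := by
    simp only [hF, one_mul, Complex.ofReal_one]
  have hmid0 : ∫ φ in (-(Real.pi / 2))..(Real.pi / 2),
        ((δ : ℂ) * (Complex.exp ((φ : ℝ) * Complex.I) * Complex.I)) •
          h (δ * Complex.exp ((φ : ℝ) * Complex.I)) =
      ∫ φ in (-(Real.pi / 2))..(Real.pi / 2), F φ := by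
    simp only [hF, mul_assoc]
  have hlowray : ∫ ρ in (Real.pi / (τ * Real.sin θ))..δ,
      Complex.exp (-(θ * Complex.I)) • h (ρ * Complex.exp (-(θ * Complex.I))) =
      -∫ ρ in δ..P / Real.sin θ, Complex.exp ((-1 * θ : ℝ) * Complex.I) •
        h (ρ * Complex.exp ((-1 * θ : ℝ) * Complex.I)) := by
    rw [hPs, intervalIntegral.integral_symm]
    simp only [Complex.ofReal_neg, neg_mul, one_mul]
  have hupray : ∫ ρ in δ..(Real.pi / (τ * Real.sin θ)),
      Complex.exp (θ * Complex.I) • h (ρ * Complex.exp (θ * Complex.I)) =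
      ∫ ρ in δ..P / Real.sin θ, Complex.exp ((1 * θ : ℝ) * Complex.I) •
        h (ρ * Complex.exp ((1 * θ : ℝ) * Complex.I)) := by
    rw [hPs]
    simp only [one_mul]
  have hF' : ∫ ψ in (-θ)..θ, (δ * Complex.exp (ψ * Complex.I) * Complex.I) •
      h (δ * Complex.exp (ψ * Complex.I)) = ∫ ψ in (-θ)..θ, F ψ := rfl
  rw [contourIntegral, hlowray, hupray, hF', hsplit, hneg]
  rw [hpos, hE1] at hup
  rw [hmid0] at hmid
  simp only [one_mul, neg_one_mul] at hup hlow hmid ⊢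
  have e1 := eq_sub_of_add_eq hup
  have e2 := eq_sub_of_add_eq hlow
  have e3 := eq_add_of_sub_eq hmid
  rw [e1, e2, e3]
  abel

/-- The half circle can be pushed arbitrarily far to the right, where the integrand is uniformly
small while the length is fixed. -/
theorem contourIntegral_eq_zero {θ δ τ : ℝ} (hτ : 0 < τ) (hδ : 0 < δ)
    (hδP : δ < Real.pi / τ) (hθ : Real.pi / 2 < θ) (hθ' : θ < Real.pi) {h : ℂ → E}
    (hh : ∀ z ∈ sectorStrip θ δ (Real.pi / τ), AnalyticAt ℂ h z)
    (hper : ∀ x : ℝ, h (x + (Real.pi / τ : ℝ) * Complex.I) =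
      h (x - (Real.pi / τ : ℝ) * Complex.I))
    (hlim : ∀ ε > 0, ∃ C : ℝ, ∀ z : ℂ, C ≤ z.re → ‖h z‖ ≤ ε) :
    contourIntegral θ δ τ h = 0 := by
  have hpi := Real.pi_pos
  have hP : 0 < Real.pi / τ := by positivity
  rw [← norm_le_zero_iff]
  refine le_of_forall_pos_le_add fun ε hε => ?_
  rw [zero_add]
  obtain ⟨C, hC⟩ := hlim (ε / (Real.pi / τ * Real.pi)) (by positivity)
  rw [contourIntegral_eq_half_circle hδ hδP hθ hθ' hh hper,
    ← integral_translate_half_circle hδ hδP hθ hh hper (le_max_right C 0)]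
  refine (intervalIntegral.norm_integral_le_of_norm_le_const
    (C := Real.pi / τ * (ε / (Real.pi / τ * Real.pi))) fun φ hφ => ?_).trans (le_of_eq ?_)
  · rw [uIoc_of_le (by linarith)] at hφ
    have hcos : 0 ≤ Real.cos φ := Real.cos_nonneg_of_mem_Icc ⟨hφ.1.le, hφ.2⟩
    rw [norm_smul, norm_mul, norm_mul, Complex.norm_I, Complex.norm_exp_ofReal_mul_I, mul_one,
      mul_one, Complex.norm_real, Real.norm_eq_abs, abs_of_pos hP]
    refine mul_le_mul_of_nonneg_left (hC _ ?_) hP.le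
    rw [Complex.add_re, Complex.re_ofReal_mul, Complex.exp_ofReal_mul_I_re, Complex.ofReal_re]
    have := mul_nonneg hP.le hcos
    linarith [le_max_left C 0]
  · rw [sub_neg_eq_add, add_halves, abs_of_pos hpi]
    field_simp

theorem contourIntegral_deriv [CompleteSpace E] (θ δ τ : ℝ) {G g : ℂ → E}
    (hG : ∀ z, HasDerivAt G (g z) z) (hg : Continuous g) :
    contourIntegral θ δ τ g =
      G ((Real.pi / (τ * Real.sin θ) : ℝ) * Complex.exp (θ * Complex.I)) -
        G ((Real.pi / (τ * Real.sin θ) : ℝ) * Complex.exp (-(θ * Complex.I))) := by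
  have hray : ∀ (w : ℂ) (a b : ℝ), ∫ ρ in a..b, w • g (ρ * w) = G (b * w) - G (a * w) := by
    intro w a b
    refine intervalIntegral.integral_eq_sub_of_hasDerivAt (f := fun ρ : ℝ => G (ρ * w)) ?_ ?_
    · intro ρ _
      have h1 : HasDerivAt (fun ρ : ℝ => (ρ : ℂ) * w) w ρ := by
        simpa using (hasDerivAt_id ρ).ofReal_comp.mul_const w
      exact HasDerivAt.scomp (h := fun ρ : ℝ => (ρ : ℂ) * w) ρ (hG _) h1
    · exact Continuous.intervalIntegrable (by fun_prop) _ _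
  have harc : ∫ ψ in (-θ)..θ, (δ * Complex.exp (ψ * Complex.I) * Complex.I) •
      g (δ * Complex.exp (ψ * Complex.I)) = G (δ * Complex.exp (θ * Complex.I)) -
        G (δ * Complex.exp (-(θ * Complex.I))) := by
    have := intervalIntegral.integral_eq_sub_of_hasDerivAt (a := -θ) (b := θ)
      (f := fun ψ : ℝ => G (δ * Complex.exp (ψ * Complex.I)))
      (f' := fun ψ : ℝ => (δ * Complex.exp (ψ * Complex.I) * Complex.I) •
        g (δ * Complex.exp (ψ * Complex.I))) ?_ ?_
    · rw [this]
      simp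
    · intro ψ _
      have h1 : HasDerivAt (fun ψ : ℝ => (δ : ℂ) * Complex.exp (ψ * Complex.I))
          (δ * Complex.exp (ψ * Complex.I) * Complex.I) ψ := by
        have := (((hasDerivAt_id ψ).ofReal_comp.mul_const Complex.I).cexp).const_mul (δ : ℂ)
        simpa [mul_assoc] using this
      exact HasDerivAt.scomp (h := fun ψ : ℝ => (δ : ℂ) * Complex.exp (ψ * Complex.I)) ψ (hG _) h1
    · exact Continuous.intervalIntegrable (by fun_prop) _ _
  rw [contourIntegral, hray, hray, harc]
  abel

/-- The end points of the contour differ by exactly one period `2πi/τ`. For `m ≠ n` the primitive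
`e^{cz}/c` takes the same value at both; for `m = n` the integrand is constant. -/
theorem contourIntegral_exp [CompleteSpace E] {θ δ τ : ℝ} (hτ : 0 < τ) (hθ : Real.sin θ ≠ 0)
    (n m : ℕ) (x : E) :
    contourIntegral θ δ τ (fun z : ℂ => Complex.exp (z * (n * τ)) •
      Complex.exp (-(z * τ)) ^ m • x) =
      (if m = n then 2 * Real.pi * Complex.I / τ else 0 : ℂ) • x := by
  have hτ' : (τ : ℂ) ≠ 0 := by exact_mod_cast hτ.ne'
  have he : ∀ z : ℂ, Complex.exp (z * (n * τ)) • Complex.exp (-(z * τ)) ^ m • x =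
      Complex.exp (z * ((n - m) * τ)) • x := by
    intro z
    rw [smul_smul, ← Complex.exp_nat_mul, ← Complex.exp_add]
    congr 2
    ring
  simp only [he]
  set c : ℂ := (n - m) * τ with hc
  set r : ℂ := ((Real.pi / (τ * Real.sin θ) : ℝ) : ℂ) with hr
  have hdiff : r * Complex.exp (θ * Complex.I) - r * Complex.exp (-(θ * Complex.I)) =
      2 * Real.pi * Complex.I / τ := by
    have hs : (Complex.sin θ) ≠ 0 := by
      rw [← Complex.ofReal_sin]; exact_mod_cast hθ
    rw [← neg_mul, Complex.exp_mul_I, Complex.exp_mul_I, Complex.cos_neg, Complex.sin_neg, hr]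
    push_cast
    field_simp
    ring
  split_ifs with h
  · have hc0 : c = 0 := by rw [hc, h, sub_self, zero_mul]
    have := contourIntegral_deriv (E := E) θ δ τ (G := fun z => z • x) (g := fun _ => x)
      (fun z => by simpa using (hasDerivAt_id z).smul_const x) continuous_const
    simp only [hc0, mul_zero, Complex.exp_zero, one_smul]
    rw [this, ← sub_smul, ← hr, hdiff]
  · have hnm : (n : ℂ) - m ≠ 0 := by
      rw [sub_ne_zero]
      exact_mod_cast fun h' : n = m => h h'.symm
    have hc0 : c ≠ 0 := mul_ne_zero hnm hτ'
    have := contourIntegral_deriv (E := E) θ δ τ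
      (G := fun z => (Complex.exp (z * c) / c) • x) (g := fun z => Complex.exp (z * c) • x)
      (fun z => by
        have h1 := ((((hasDerivAt_id z).mul_const c).cexp).div_const c).smul_const x
        simpa [hc0] using h1) (by fun_prop)
    rw [this, ← sub_smul, ← hr, ← sub_div]
    have hper : Complex.exp (r * Complex.exp (θ * Complex.I) * c) =
        Complex.exp (r * Complex.exp (-(θ * Complex.I)) * c) := by
      rw [Complex.exp_eq_exp_iff_exists_int]
      refine ⟨(n : ℤ) - m, ?_⟩
      have h2 : r * Complex.exp (θ * Complex.I) =
          r * Complex.exp (-(θ * Complex.I)) + 2 * Real.pi * Complex.I / τ := by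
        rw [← hdiff]; ring
      rw [h2, hc]
      push_cast
      field_simp
    rw [hper, sub_self, zero_div]

end Contour

/-! ### Taylor expansions in `ζ` -/

section Taylor

variable {E : Type*} [NormedAddCommGroup E] [NormedSpace ℂ E]

/-- `f` has the asymptotic Taylor expansion `∑ c_n ζ^n` at `0`, to every order. -/
def IsTaylor (f : ℂ → E) (c : ℕ → E) : Prop :=
  ∀ M : ℕ, (fun ζ : ℂ => f ζ - ∑ n ∈ Finset.range M, ζ ^ n • c n) =O[𝓝 0] fun ζ : ℂ => ‖ζ‖ ^ M

theorem IsTaylor.add {f g : ℂ → E} {c d : ℕ → E} (hf : IsTaylor f c) (hg : IsTaylor g d) :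
    IsTaylor (fun ζ => f ζ + g ζ) fun n => c n + d n := fun M => by
  refine ((hf M).add (hg M)).congr_left fun ζ => ?_
  simp only [smul_add, Finset.sum_add_distrib]
  abel

theorem IsTaylor.const_smul {f : ℂ → E} {c : ℕ → E} (hf : IsTaylor f c) (a : ℂ) :
    IsTaylor (fun ζ => a • f ζ) fun n => a • c n := fun M => by
  refine ((hf M).const_smul_left a).congr_left fun ζ => ?_
  simp only [Pi.smul_apply, smul_sub, Finset.smul_sum]
  simp only [smul_comm a]

theorem IsTaylor.smul_const {f : ℂ → ℂ} {c : ℕ → ℂ} (hf : IsTaylor f c) (x : E) :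
    IsTaylor (fun ζ => f ζ • x) fun n => c n • x := fun M => by
  have h := (hf M).smul (Asymptotics.isBigO_refl (fun _ : ℂ => x) (𝓝 0))
  have h' : (fun ζ : ℂ => ‖ζ‖ ^ M • x) =O[𝓝 0] fun ζ : ℂ => ‖ζ‖ ^ M := by
    refine Asymptotics.IsBigO.of_bound ‖x‖ (Eventually.of_forall fun ζ => ?_)
    rw [norm_smul, mul_comm]
  refine (h.trans h').congr_left fun ζ => ?_
  simp only [sub_smul, Finset.sum_smul, smul_assoc]

theorem IsTaylor.sum {ι : Type*} (s : Finset ι) {f : ι → ℂ → E} {c : ι → ℕ → E}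
    (hf : ∀ i ∈ s, IsTaylor (f i) (c i)) :
    IsTaylor (fun ζ => ∑ i ∈ s, f i ζ) fun n => ∑ i ∈ s, c i n := fun M => by
  refine (Asymptotics.IsBigO.sum fun i hi => hf i hi M).congr_left fun ζ => ?_
  simp only [Finset.sum_apply, Finset.smul_sum, Finset.sum_sub_distrib]
  rw [Finset.sum_comm (s := s)]

theorem IsTaylor.congr_coeff {f : ℂ → E} {c d : ℕ → E} (hf : IsTaylor f c) (h : ∀ n, c n = d n) :
    IsTaylor f d := by
  rwa [← funext h]

theorem isTaylor_pow (j : ℕ) : IsTaylor (fun ζ : ℂ => ζ ^ j) fun n => if n = j then 1 else 0 := by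
  intro M
  by_cases h : j < M
  · refine (Asymptotics.isBigO_zero _ _).congr_left fun ζ => ?_
    simp [h]
  · refine Asymptotics.IsBigO.of_bound 1 ?_
    filter_upwards [Metric.ball_mem_nhds (0 : ℂ) one_pos] with ζ hζ
    have h1 : ‖ζ‖ ≤ 1 := (mem_ball_zero_iff.1 hζ).le
    simp only [smul_eq_mul, mul_ite, mul_one, mul_zero, Finset.sum_ite_eq', Finset.mem_range, h,
      if_false, sub_zero, norm_pow, norm_norm, one_mul]
    exact pow_le_pow_of_le_one (norm_nonneg _) h1 (not_lt.1 h)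

theorem isTaylor_sum_pow (s : Finset ℕ) (a : ℕ → ℂ) :
    IsTaylor (fun ζ : ℂ => ∑ j ∈ s, a j * ζ ^ j) fun n => if n ∈ s then a n else 0 := by
  refine (IsTaylor.sum s fun j _ => (isTaylor_pow j).const_smul (a j)).congr_coeff fun n => ?_
  simp

theorem isTaylor_of_hasSum {f : ℂ → E} {c : ℕ → E}
    (h : ∀ᶠ ζ in 𝓝 (0 : ℂ), HasSum (fun n : ℕ => ζ ^ n • c n) (f ζ)) : IsTaylor f c := by
  let p : FormalMultilinearSeries ℂ ℂ E := fun n =>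
    ContinuousMultilinearMap.mkPiRing ℂ (Fin n) (c n)
  have hp : HasFPowerSeriesAt f p 0 := by
    refine hasFPowerSeriesAt_iff.2 ?_
    filter_upwards [h] with ζ hζ
    simpa [FormalMultilinearSeries.coeff, p] using hζ
  intro M
  have := hp.isBigO_sub_partialSum_pow M
  simpa [FormalMultilinearSeries.partialSum, p] using this

theorem isTaylor_of_analyticAt {f : ℂ → ℂ} (h : AnalyticAt ℂ f 0) :
    IsTaylor f fun n => iteratedDeriv n f 0 / (n.factorial : ℂ) := by
  intro M
  have := h.hasFPowerSeriesAt.isBigO_sub_partialSum_pow M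
  simpa [FormalMultilinearSeries.partialSum, mul_comm] using this

/-- A partial sum plus `ζ^M` times a function analytic off 1 keeps this shape under `ζ d/dζ`. The
case `M = 0` yields analyticity off 1, general `M` the expansion at 0. -/
theorem gammaFn_eq (M ℓ : ℕ) : ∃ h : ℂ → ℂ, AnalyticOnNhd ℂ h {1}ᶜ ∧ ∀ ζ ≠ 1,
    gammaFn ℓ ζ = (∑ n ∈ Finset.range M, (n : ℂ) ^ ℓ * ζ ^ n) + ζ ^ M * h ζ := by
  induction ℓ with
  | zero =>
    refine ⟨fun ζ => (1 - ζ)⁻¹, fun ζ hζ => ?_, fun ζ hζ => ?_⟩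
    · exact (analyticAt_const.sub analyticAt_id).inv (sub_ne_zero.2 (Ne.symm hζ))
    · have h1 : 1 - ζ ≠ 0 := sub_ne_zero.2 hζ.symm
      have h2 := mul_neg_geom_sum ζ M
      simp only [gammaFn, pow_zero, one_mul]
      field_simp
      linear_combination -h2
  | succ ℓ ih =>
    obtain ⟨h, ha, he⟩ := ih
    refine ⟨fun ζ => M * h ζ + ζ * deriv h ζ, fun ζ hζ => ?_, fun ζ hζ => ?_⟩
    · exact (analyticAt_const.mul (ha ζ hζ)).add (analyticAt_id.mul (ha ζ hζ).deriv)
    · have hev : gammaFn ℓ =ᶠ[𝓝 ζ]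
          fun ζ => (∑ n ∈ Finset.range M, (n : ℂ) ^ ℓ * ζ ^ n) + ζ ^ M * h ζ := by
        filter_upwards [isOpen_ne.mem_nhds hζ] with ξ hξ using he ξ hξ
      have hd : HasDerivAt
          (fun ζ : ℂ => (∑ n ∈ Finset.range M, (n : ℂ) ^ ℓ * ζ ^ n) + ζ ^ M * h ζ)
          ((∑ n ∈ Finset.range M, (n : ℂ) ^ ℓ * (n * ζ ^ (n - 1))) +
            (M * ζ ^ (M - 1) * h ζ + ζ ^ M * deriv h ζ)) ζ :=
        (HasDerivAt.fun_sum fun n _ => (hasDerivAt_pow n ζ).const_mul _).add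
          ((hasDerivAt_pow M ζ).mul (ha ζ hζ).differentiableAt.hasDerivAt)
      have hpow : ∀ n : ℕ, ζ * (n * ζ ^ (n - 1)) = n * ζ ^ n := by
        rintro (_ | n)
        · simp
        · rw [Nat.add_sub_cancel, pow_succ]; ring
      simp only [gammaFn]
      rw [hev.deriv_eq, hd.deriv, mul_add, Finset.mul_sum]
      congr 1
      · refine Finset.sum_congr rfl fun n _ => ?_
        linear_combination (n : ℂ) ^ ℓ * hpow n
      · linear_combination h ζ * hpow M

theorem analyticAt_gammaFn (ℓ : ℕ) {ζ : ℂ} (hζ : ζ ≠ 1) : AnalyticAt ℂ (gammaFn ℓ) ζ := by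
  obtain ⟨h, ha, he⟩ := gammaFn_eq 0 ℓ
  refine (ha ζ hζ).congr ?_
  filter_upwards [isOpen_ne.mem_nhds hζ] with ξ hξ
  rw [he ξ hξ]
  simp

theorem isTaylor_gammaFn (ℓ : ℕ) : IsTaylor (gammaFn ℓ) fun n => (n : ℂ) ^ ℓ := by
  intro M
  obtain ⟨h, ha, he⟩ := gammaFn_eq M ℓ
  have h0 : h =O[𝓝 0] fun _ : ℂ => (1 : ℝ) :=
    (ha 0 zero_ne_one).continuousAt.tendsto.isBigO_one ℝ
  have h1 : (fun ζ : ℂ => ζ ^ M) =O[𝓝 0] fun ζ : ℂ => ‖ζ‖ ^ M :=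
    Asymptotics.IsBigO.of_bound 1 (Eventually.of_forall fun ζ => by simp)
  have h2 := h1.mul h0
  simp only [mul_one] at h2
  refine h2.congr' ?_ EventuallyEq.rfl
  filter_upwards [isOpen_ne.mem_nhds (zero_ne_one : (0 : ℂ) ≠ 1)] with ξ hξ
  rw [he ξ hξ]
  simp [mul_comm]

/-- Cauchy product of an expansion with a polynomial. -/
theorem IsTaylor.smul_polynomial {f : ℂ → ℂ} {c : ℕ → ℂ} (hf : IsTaylor f c) (w : ℕ → E) (N : ℕ) :
    (fun ζ : ℂ => f ζ • (∑ m ∈ Finset.range (N + 1), ζ ^ m • w m) -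
      ∑ n ∈ Finset.range (N + 1), ζ ^ n • ∑ j ∈ Finset.range (n + 1), c j • w (n - j))
      =O[𝓝 0] fun ζ : ℂ => ‖ζ‖ ^ (N + 1) := by
  have hterm : ∀ m ∈ Finset.range (N + 1), (fun ζ : ℂ =>
      ζ ^ m • (f ζ • w m - ∑ n ∈ Finset.range (N + 1 - m), ζ ^ n • c n • w m)) =O[𝓝 0]
        fun ζ : ℂ => ‖ζ‖ ^ (N + 1) := by
    intro m hm
    have h1 := (hf.smul_const (w m)) (N + 1 - m)
    have h2 : (fun ζ : ℂ => ζ ^ m) =O[𝓝 0] fun ζ : ℂ => ‖ζ‖ ^ m :=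
      Asymptotics.IsBigO.of_bound 1 (Eventually.of_forall fun ζ => by simp)
    have hm' : m + (N + 1 - m) = N + 1 := by have := Finset.mem_range.1 hm; omega
    refine (h2.smul h1).congr_right fun ζ => ?_
    rw [smul_eq_mul, ← pow_add, hm']
  refine (Asymptotics.IsBigO.sum hterm).congr_left fun ζ => ?_
  simp only [Finset.sum_apply, smul_sub, Finset.sum_sub_distrib, Finset.smul_sum]
  congr 1
  · exact Finset.sum_congr rfl fun m _ => smul_comm _ _ _
  · have hflip : ∀ n, ∑ j ∈ Finset.range (n + 1), ζ ^ n • c j • w (n - j) =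
        ∑ i ∈ Finset.range (n + 1), ζ ^ i • ζ ^ (n - i) • c (n - i) • w i := by
      intro n
      rw [← Finset.sum_flip]
      refine Finset.sum_congr rfl fun j hj => ?_
      have hj' : j ≤ n := Nat.lt_succ_iff.1 (Finset.mem_range.1 hj)
      rw [Nat.sub_sub_self hj', smul_smul (ζ ^ j), ← pow_add, Nat.add_sub_cancel' hj']
    simp only [hflip]
    exact (Finset.sum_range_diag_flip (N + 1)
      (fun i l => ζ ^ i • ζ ^ l • c l • w i)).symm

end Taylor

/-! ### Expansion of the fractional symbol -/

section Symbol

theorem bdf_zero_mem_slitPlane {k : ℕ} (hk : 1 ≤ k) : bdf k 0 ∈ Complex.slitPlane := by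
  have := bdf_ofReal_re_pos hk (x := 0) one_pos
  rw [Complex.ofReal_zero] at this
  exact Or.inl this

theorem analyticAt_bdfStep_cpow {k : ℕ} (α τ : ℝ) {ζ : ℂ}
    (h : bdfStep k τ ζ ∈ Complex.slitPlane) :
    AnalyticAt ℂ (fun ζ => bdfStep k τ ζ ^ (α : ℂ)) ζ := by
  have : Differentiable ℂ (bdfStep k τ) := (differentiable_bdf k).const_mul _
  exact (this.analyticAt ζ).cpow analyticAt_const h

theorem bdfStep_cpow {k : ℕ} {α τ : ℝ} (hα : 0 < α) (hτ : 0 < τ) (ζ : ℂ) :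
    bdfStep k τ ζ ^ (α : ℂ) = (((τ ^ α)⁻¹ : ℝ) : ℂ) * bdf k ζ ^ (α : ℂ) := by
  have hα' : (α : ℂ) ≠ 0 := by exact_mod_cast hα.ne'
  have hb : bdfStep k τ ζ = ((τ⁻¹ : ℝ) : ℂ) * bdf k ζ := by simp [bdfStep]
  rw [hb]
  by_cases h0 : bdf k ζ = 0
  · rw [h0, mul_zero, Complex.zero_cpow hα', mul_zero]
  · have hτ' : ((τ⁻¹ : ℝ) : ℂ) ≠ 0 := by
      exact_mod_cast (inv_pos.2 hτ).ne'
    rw [Complex.cpow_def_of_ne_zero (mul_ne_zero hτ' h0), Complex.cpow_def_of_ne_zero h0,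
      Complex.log_ofReal_mul (inv_pos.2 hτ) h0, add_mul, Complex.exp_add, ← Real.inv_rpow hτ.le,
      Real.rpow_def_of_pos (inv_pos.2 hτ)]
    push_cast
    rfl

theorem isTaylor_bdfStep_cpow {k : ℕ} (hk : 1 ≤ k) {α τ : ℝ} (hα : 0 < α) (hτ : 0 < τ) :
    IsTaylor (fun ζ => bdfStep k τ ζ ^ (α : ℂ))
      fun n => (((τ ^ α)⁻¹ : ℝ) : ℂ) * cqWeight k α n := by
  have ha : AnalyticAt ℂ (fun ζ : ℂ => bdf k ζ ^ (α : ℂ)) 0 :=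
    ((differentiable_bdf k).analyticAt 0).cpow analyticAt_const (bdf_zero_mem_slitPlane hk)
  have h := (isTaylor_of_analyticAt ha).const_smul (((τ ^ α)⁻¹ : ℝ) : ℂ)
  simp only [smul_eq_mul] at h
  rw [funext fun ζ => bdfStep_cpow hα hτ ζ]
  exact h

end Symbol

/-! ### Linearity of the contour integral and extraction of coefficients -/

section Contour

variable {E : Type*} [NormedAddCommGroup E] [NormedSpace ℂ E]

theorem arc_mem_sectorStrip {θ δ P : ℝ} (hδ : 0 < δ) (hδP : δ < P) (hθ' : θ < Real.pi) {ψ : ℝ}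
    (hψ : ψ ∈ Icc (-θ) θ) : (δ : ℂ) * Complex.exp (ψ * Complex.I) ∈ sectorStrip θ δ P :=
  polar_mem_sectorStrip hδ hθ' le_rfl (abs_le.2 hψ) (by
    have := Real.abs_sin_le_one ψ
    nlinarith)

theorem ray_mem_sectorStrip {θ δ P : ℝ} (hδ : 0 < δ) (hθ : 0 < θ) (hθ' : θ < Real.pi) {ρ : ℝ}
    (hρ : δ ≤ ρ) (hρ' : ρ * Real.sin θ ≤ P) :
    (ρ : ℂ) * Complex.exp (θ * Complex.I) ∈ sectorStrip θ δ P ∧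
      (ρ : ℂ) * Complex.exp (-(θ * Complex.I)) ∈ sectorStrip θ δ P := by
  have hs := (Real.sin_pos_of_pos_of_lt_pi hθ hθ').le
  have h2 := polar_mem_sectorStrip (θ := θ) (P := P) (x := -θ) hδ hθ' hρ
    (by rw [abs_neg, abs_of_pos hθ]) (by rwa [Real.sin_neg, abs_neg, abs_of_nonneg hs])
  rw [Complex.ofReal_neg, neg_mul] at h2
  exact ⟨polar_mem_sectorStrip hδ hθ' hρ (abs_of_pos hθ).le (by rwa [abs_of_nonneg hs]), h2⟩

theorem contour_subset_sectorStrip {θ δ τ : ℝ} (hδ : 0 < δ) (hθ : 0 < θ) (hθ' : θ < Real.pi) :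
    contour θ δ τ ⊆ sectorStrip θ δ (Real.pi / τ) := by
  have habs : |θ| ≤ θ := (abs_of_pos hθ).le
  rintro z ⟨h | ⟨ρ, hρ, h⟩, him⟩
  · exact ⟨h.1.ge, h.2, him⟩
  · have hρ0 : 0 < ρ := hδ.trans_le hρ
    rcases h with rfl | rfl
    · exact ⟨by rwa [norm_polar hρ0.le], by rwa [arg_polar hρ0 (habs.trans_lt hθ')], him⟩
    · have e : -((θ : ℂ) * Complex.I) = ((-θ : ℝ) : ℂ) * Complex.I := by simp
      rw [e] at him ⊢
      exact ⟨by rwa [norm_polar hρ0.le],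
        by rwa [arg_polar hρ0 (by rw [abs_neg]; exact habs.trans_lt hθ'), abs_neg], him⟩

theorem le_rayEnd_and_ray_mem {θ δ τ : ℝ} (hδ : 0 < δ) (hδP : δ < Real.pi / τ) (hθ : 0 < θ)
    (hθ' : θ < Real.pi) :
    δ ≤ Real.pi / (τ * Real.sin θ) ∧
    ∀ ρ ∈ Icc δ (Real.pi / (τ * Real.sin θ)),
      (ρ : ℂ) * Complex.exp (θ * Complex.I) ∈ sectorStrip θ δ (Real.pi / τ) ∧
      (ρ : ℂ) * Complex.exp (-(θ * Complex.I)) ∈ sectorStrip θ δ (Real.pi / τ) := by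
  have hs := Real.sin_pos_of_pos_of_lt_pi hθ hθ'
  rw [← div_div]
  refine ⟨hδP.le.trans ?_, fun ρ hρ => ray_mem_sectorStrip hδ hθ hθ' hρ.1 ?_⟩
  · rw [le_div_iff₀ hs]
    have : 0 < Real.pi / τ := hδ.trans hδP
    nlinarith [Real.sin_le_one θ]
  · exact (le_div_iff₀ hs).1 hρ.2

theorem contourIntegral_congr {θ δ τ : ℝ} (hδ : 0 < δ) (hδP : δ < Real.pi / τ) (hθ : 0 < θ)
    (hθ' : θ < Real.pi)
    {f g : ℂ → E} (h : EqOn f g (sectorStrip θ δ (Real.pi / τ))) :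
    contourIntegral θ δ τ f = contourIntegral θ δ τ g := by
  obtain ⟨hle, hray⟩ := le_rayEnd_and_ray_mem hδ hδP hθ hθ'
  unfold contourIntegral
  congr 1
  · congr 1
    · refine intervalIntegral.integral_congr fun ρ hρ => ?_
      rw [uIcc_of_ge hle] at hρ
      simp only [h (hray ρ hρ).2]
    · refine intervalIntegral.integral_congr fun ψ hψ => ?_
      rw [uIcc_of_le (by linarith)] at hψ
      simp only [h (arc_mem_sectorStrip hδ hδP hθ' hψ)]
  · refine intervalIntegral.integral_congr fun ρ hρ => ?_
    rw [uIcc_of_le hle] at hρ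
    simp only [h (hray ρ hρ).1]

theorem contourIntegral_add {θ δ τ : ℝ} (hδ : 0 < δ) (hδP : δ < Real.pi / τ) (hθ : 0 < θ)
    (hθ' : θ < Real.pi)
    {f g : ℂ → E} (hf : ContinuousOn f (sectorStrip θ δ (Real.pi / τ)))
    (hg : ContinuousOn g (sectorStrip θ δ (Real.pi / τ))) :
    contourIntegral θ δ τ (fun z => f z + g z) =
      contourIntegral θ δ τ f + contourIntegral θ δ τ g := by
  obtain ⟨hle, hray⟩ := le_rayEnd_and_ray_mem hδ hδP hθ hθ'
  have hup : ∀ {f : ℂ → E}, ContinuousOn f (sectorStrip θ δ (Real.pi / τ)) →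
      IntervalIntegrable (fun ρ : ℝ => Complex.exp (θ * Complex.I) •
        f (ρ * Complex.exp (θ * Complex.I))) volume δ (Real.pi / (τ * Real.sin θ)) := by
    intro f hf
    refine ContinuousOn.intervalIntegrable (continuousOn_const.smul
      (hf.comp (by fun_prop) fun ρ hρ => ?_))
    rw [uIcc_of_le hle] at hρ
    exact (hray ρ hρ).1
  have hlow : ∀ {f : ℂ → E}, ContinuousOn f (sectorStrip θ δ (Real.pi / τ)) →
      IntervalIntegrable (fun ρ : ℝ => Complex.exp (-(θ * Complex.I)) •
        f (ρ * Complex.exp (-(θ * Complex.I)))) volume (Real.pi / (τ * Real.sin θ)) δ := by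
    intro f hf
    refine ContinuousOn.intervalIntegrable (continuousOn_const.smul
      (hf.comp (by fun_prop) fun ρ hρ => ?_))
    rw [uIcc_of_ge hle] at hρ
    exact (hray ρ hρ).2
  have harc : ∀ {f : ℂ → E}, ContinuousOn f (sectorStrip θ δ (Real.pi / τ)) →
      IntervalIntegrable (fun ψ : ℝ => (δ * Complex.exp (ψ * Complex.I) * Complex.I) •
        f (δ * Complex.exp (ψ * Complex.I))) volume (-θ) θ := by
    intro f hf
    refine ContinuousOn.intervalIntegrable (ContinuousOn.smul (by fun_prop)
      (hf.comp (by fun_prop) fun ψ hψ => ?_))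
    rw [uIcc_of_le (by linarith)] at hψ
    exact arc_mem_sectorStrip hδ hδP hθ' hψ
  simp only [contourIntegral, smul_add]
  rw [intervalIntegral.integral_add (hup hf) (hup hg),
    intervalIntegral.integral_add (hlow hf) (hlow hg),
    intervalIntegral.integral_add (harc hf) (harc hg)]
  abel

theorem contourIntegral_sum {θ δ τ : ℝ} (hδ : 0 < δ) (hδP : δ < Real.pi / τ) (hθ : 0 < θ)
    (hθ' : θ < Real.pi)
    {ι : Type*} (s : Finset ι) {f : ι → ℂ → E}
    (hf : ∀ i ∈ s, ContinuousOn (f i) (sectorStrip θ δ (Real.pi / τ))) :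
    contourIntegral θ δ τ (fun z => ∑ i ∈ s, f i z) = ∑ i ∈ s, contourIntegral θ δ τ (f i) := by
  classical
  induction s using Finset.induction_on with
  | empty => simp [contourIntegral]
  | insert i s hi ih =>
    have h1 : ∀ j ∈ s, ContinuousOn (f j) (sectorStrip θ δ (Real.pi / τ)) := fun j hj =>
      hf j (Finset.mem_insert_of_mem hj)
    simp only [Finset.sum_insert hi]
    rw [contourIntegral_add hδ hδP hθ hθ' (hf i (Finset.mem_insert_self i s))
      (continuousOn_finsetSum s h1), ih h1]

theorem contourIntegral_smul {θ δ τ : ℝ} (c : ℂ) (f : ℂ → E) :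
    contourIntegral θ δ τ (fun z => c • f z) = c • contourIntegral θ δ τ f := by
  simp only [contourIntegral, smul_comm _ c, intervalIntegral.integral_smul, smul_add]

/-- The contour integral extracts the Taylor coefficients of a function of `ζ = e^{-zτ}`. -/
theorem contourIntegral_exp_smul [CompleteSpace E] {θ δ τ : ℝ} (hτ : 0 < τ) (hδ : 0 < δ)
    (hδP : δ < Real.pi / τ) (hθ : Real.pi / 2 < θ) (hθ' : θ < Real.pi) {G : ℂ → E}
    (hG : ∀ z ∈ sectorStrip θ δ (Real.pi / τ), AnalyticAt ℂ G (Complex.exp (-(z * τ))))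
    {w : ℕ → E} {N : ℕ}
    (hO : (fun ζ : ℂ => G ζ - ∑ m ∈ Finset.range (N + 1), ζ ^ m • w m) =O[𝓝 0]
      fun ζ : ℂ => ‖ζ‖ ^ (N + 1)) {n : ℕ} (hn : n ≤ N) :
    contourIntegral θ δ τ (fun z : ℂ => Complex.exp (z * (n * τ)) • G (Complex.exp (-(z * τ)))) =
      (2 * Real.pi * Complex.I / τ : ℂ) • w n := by
  have hpi := Real.pi_pos
  have hτ0 : (τ : ℂ) ≠ 0 := by exact_mod_cast hτ.ne'
  have hθ0 : 0 < θ := by linarith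
  -- The remainder is `O(ζ^{N+1})`, which for `n ≤ N` outweighs `e^{z t_n} = ζ^{-n}` as `Re z → ∞`;
  -- the polynomial is left to orthogonality.
  set D : ℂ → E := fun ζ => G ζ - ∑ m ∈ Finset.range (N + 1), ζ ^ m • w m with hD
  have hexpa : ∀ z : ℂ, AnalyticAt ℂ (fun z : ℂ => Complex.exp (-(z * τ))) z := fun z =>
    Differentiable.analyticAt (by fun_prop) z
  have hexpb : ∀ z : ℂ, AnalyticAt ℂ (fun z : ℂ => Complex.exp (z * (n * τ))) z := fun z =>
    Differentiable.analyticAt (by fun_prop) z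
  have hDa : ∀ z ∈ sectorStrip θ δ (Real.pi / τ), AnalyticAt ℂ
      (fun z : ℂ => Complex.exp (z * (n * τ)) • D (Complex.exp (-(z * τ)))) z := by
    intro z hz
    have h1 : AnalyticAt ℂ D (Complex.exp (-(z * τ))) :=
      (hG z hz).sub (Finset.analyticAt_fun_sum _ fun m _ =>
        (analyticAt_id.pow m).smul analyticAt_const)
    exact (hexpb z).smul (AnalyticAt.comp (f := fun z : ℂ => Complex.exp (-(z * τ))) h1 (hexpa z))
  have hzero := contourIntegral_eq_zero hτ hδ hδP hθ hθ' hDa ?_ ?_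
  · have hsplit : ∀ z : ℂ, Complex.exp (z * (n * τ)) • G (Complex.exp (-(z * τ))) =
        Complex.exp (z * (n * τ)) • D (Complex.exp (-(z * τ))) +
          ∑ m ∈ Finset.range (N + 1), Complex.exp (z * (n * τ)) •
            Complex.exp (-(z * τ)) ^ m • w m := by
      intro z
      rw [← Finset.smul_sum, ← smul_add]
      simp only [hD, sub_add_cancel]
    have hc : ∀ m ∈ Finset.range (N + 1), ContinuousOn (fun z : ℂ => Complex.exp (z * (n * τ)) •
        Complex.exp (-(z * τ)) ^ m • w m) (sectorStrip θ δ (Real.pi / τ)) := fun m _ =>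
      Continuous.continuousOn (by fun_prop)
    simp only [hsplit]
    rw [contourIntegral_add hδ hδP hθ0 hθ'
      (fun z hz => (hDa z hz).continuousAt.continuousWithinAt) (continuousOn_finsetSum _ hc),
      hzero, zero_add, contourIntegral_sum hδ hδP hθ0 hθ' _ hc]
    simp only [contourIntegral_exp hτ (Real.sin_pos_of_pos_of_lt_pi hθ0 hθ').ne']
    rw [Finset.sum_eq_single n]
    · rw [if_pos rfl]
    · intro m _ hm
      rw [if_neg hm, zero_smul]
    · intro h
      exact absurd (Finset.mem_range.2 (Nat.lt_succ_of_le hn)) h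
  · intro x
    have e1 : Complex.exp ((x + (Real.pi / τ : ℝ) * Complex.I) * (n * τ)) =
        Complex.exp ((x - (Real.pi / τ : ℝ) * Complex.I) * (n * τ)) := by
      rw [Complex.exp_eq_exp_iff_exists_int]
      refine ⟨n, ?_⟩
      push_cast
      field_simp
      ring
    have e2 : Complex.exp (-((x + (Real.pi / τ : ℝ) * Complex.I) * τ)) =
        Complex.exp (-((x - (Real.pi / τ : ℝ) * Complex.I) * τ)) := by
      rw [Complex.exp_eq_exp_iff_exists_int]
      refine ⟨-1, ?_⟩
      push_cast
      field_simp
      ring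
    simp only [e1, e2]
  · intro ε hε
    obtain ⟨C, hC0, hC⟩ := hO.exists_pos
    rw [Asymptotics.isBigOWith_iff, Metric.eventually_nhds_iff] at hC
    obtain ⟨r, hr, hC⟩ := hC
    have hlim : Tendsto (fun x : ℝ => Real.exp (-(x * τ))) atTop (𝓝 0) :=
      Real.tendsto_exp_neg_atTop_nhds_zero.comp (tendsto_id.atTop_mul_const hτ)
    have hev : ∀ᶠ x : ℝ in atTop, Real.exp (-(x * τ)) < r ∧ C * Real.exp (-(x * τ)) < ε ∧ 0 ≤ x :=
      (hlim.eventually_lt_const hr).and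
        (((by simpa using hlim.const_mul C : Tendsto (fun x : ℝ => C * Real.exp (-(x * τ)))
          atTop (𝓝 0)).eventually_lt_const hε).and (eventually_ge_atTop 0))
    obtain ⟨x₀, hx₀⟩ := eventually_atTop.1 hev
    refine ⟨x₀, fun z hz => ?_⟩
    obtain ⟨h1, h2, h3⟩ := hx₀ z.re hz
    have hnorm : ‖Complex.exp (-(z * τ))‖ = Real.exp (-(z.re * τ)) := by
      rw [Complex.norm_exp, Complex.neg_re, Complex.re_mul_ofReal]
    have hnorm' : ‖Complex.exp (z * (n * τ))‖ = Real.exp (z.re * τ) ^ n := by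
      rw [Complex.norm_exp, ← Real.exp_nat_mul]
      congr 1
      have : z * (n * τ) = z * ((n * τ : ℝ) : ℂ) := by push_cast; ring
      rw [this, Complex.re_mul_ofReal]
      ring
    have h4 := hC (show dist (Complex.exp (-(z * τ))) 0 < r by rwa [dist_zero_right, hnorm])
    rw [norm_smul, hnorm']
    rw [norm_pow, norm_norm, hnorm] at h4
    set q : ℝ := Real.exp (-(z.re * τ)) with hq
    have hq0 : 0 < q := Real.exp_pos _
    have hq1 : q ≤ 1 := Real.exp_le_one_iff.2 (by nlinarith)
    have hpq : Real.exp (z.re * τ) * q = 1 := by rw [hq, ← Real.exp_add]; simp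
    calc Real.exp (z.re * τ) ^ n * ‖D (Complex.exp (-(z * τ)))‖
        ≤ Real.exp (z.re * τ) ^ n * (C * q ^ (N + 1)) := by gcongr
      _ ≤ Real.exp (z.re * τ) ^ n * (C * q ^ (n + 1)) := by
          have : q ^ (N + 1) ≤ q ^ (n + 1) := pow_le_pow_of_le_one hq0.le hq1 (by omega)
          gcongr
      _ = C * q * (Real.exp (z.re * τ) * q) ^ n := by rw [mul_pow]; ring
      _ ≤ ε := by rw [hpq, one_pow, mul_one]; exact h2.le

end Contour

/-! ### The resolvent applied to the generating function of the data -/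

section Solution

variable {X : Type*} [NormedAddCommGroup X] [NormedSpace ℂ X] [CompleteSpace X]

theorem analyticAt_resolvent_bdfStep {A : X →ₗ.[ℂ] X} (hA : ResolventEstimate A) {k : ℕ}
    {α τ : ℝ} (h0 : 0 < α) (h1 : α < 1) {ζ : ℂ} (h : bdfStep k τ ζ ∈ Complex.slitPlane) :
    AnalyticAt ℂ (fun ζ => resolvent A (bdfStep k τ ζ ^ (α : ℂ))) ζ :=
  AnalyticAt.comp (f := fun ζ => bdfStep k τ ζ ^ (α : ℂ))
    (analyticAt_resolvent (hA.mem_resolventSet (cpow_mem_slitPlane h0 h1 h)))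
    (analyticAt_bdfStep_cpow α τ h)

/-- With `Y(ζ) = ∑_{m ≤ N} w_m ζ^m`, the equations say that `(δ_τ^α - A) Y` and `F` have the same
coefficients up to order `N`. The difference is `O(ζ^{N+1})`, and the resolvent is bounded near 0.
-/
theorem isBigO_resolvent_sub {A : X →ₗ.[ℂ] X} (hA : ResolventEstimate A) {k : ℕ} (hk : 1 ≤ k)
    {α τ : ℝ} (h0 : 0 < α) (h1 : α < 1) (hτ : 0 < τ) {F : ℂ → X} {c : ℕ → X}
    (hF : IsTaylor F c) {w : ℕ → A.domain} {N : ℕ}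
    (hw : ∀ n ≤ N, cqDeriv k α τ (fun m => (w m : X)) n - A (w n) = c n) :
    (fun ζ : ℂ => resolvent A (bdfStep k τ ζ ^ (α : ℂ)) (F ζ) -
      ∑ m ∈ Finset.range (N + 1), ζ ^ m • (w m : X)) =O[𝓝 0] fun ζ : ℂ => ‖ζ‖ ^ (N + 1) := by
  have hslit : bdfStep k τ 0 ∈ Complex.slitPlane :=
    bdfStep_mem_slitPlane hτ (bdf_zero_mem_slitPlane hk)
  have hres := (analyticAt_resolvent_bdfStep hA h0 h1 hslit).continuousAt
  have hres1 : (fun ζ => resolvent A (bdfStep k τ ζ ^ (α : ℂ))) =O[𝓝 0] fun _ : ℂ => (1 : ℝ) :=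
    hres.tendsto.isBigO_one ℝ
  have hev : ∀ᶠ ζ in 𝓝 (0 : ℂ), bdfStep k τ ζ ∈ Complex.slitPlane := by
    have hc : ContinuousAt (bdfStep k τ) 0 :=
      ((differentiable_bdf k).const_mul (1 / (τ : ℂ))).continuous.continuousAt
    exact hc.eventually (Complex.isOpen_slitPlane.mem_nhds hslit)
  have hprod := (isTaylor_bdfStep_cpow hk h0 hτ).smul_polynomial (fun m => (w m : X)) N
  have hdiff := (hF (N + 1)).sub hprod
  have hmain : (fun ζ => resolvent A (bdfStep k τ ζ ^ (α : ℂ))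
      ((F ζ - ∑ n ∈ Finset.range (N + 1), ζ ^ n • c n) -
        (bdfStep k τ ζ ^ (α : ℂ) • (∑ m ∈ Finset.range (N + 1), ζ ^ m • (w m : X)) -
          ∑ n ∈ Finset.range (N + 1), ζ ^ n • ∑ j ∈ Finset.range (n + 1),
            ((((τ ^ α)⁻¹ : ℝ) : ℂ) * cqWeight k α j) • (w (n - j) : X)))) =O[𝓝 0]
      fun ζ : ℂ => ‖ζ‖ ^ (N + 1) := by
    have h := hres1.norm_left.mul hdiff.norm_left
    simp only [one_mul] at h
    refine Asymptotics.IsBigO.trans (Asymptotics.IsBigO.of_bound 1 ?_) h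
    refine Eventually.of_forall fun ζ => ?_
    rw [one_mul, norm_mul, norm_norm, norm_norm]
    exact ContinuousLinearMap.le_opNorm _ _
  refine hmain.congr' ?_ EventuallyEq.rfl
  filter_upwards [hev] with ζ hζ
  set Y : A.domain := ∑ m ∈ Finset.range (N + 1), ζ ^ m • w m with hY
  have hYc : (Y : X) = ∑ m ∈ Finset.range (N + 1), ζ ^ m • (w m : X) := by
    rw [hY]; push_cast; rfl
  have hAY : A Y = ∑ m ∈ Finset.range (N + 1), ζ ^ m • A (w m) := by
    rw [hY, ← LinearPMap.toFun_eq_coe, map_sum]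
    simp only [map_smul]
    rfl
  -- `Y` is a finite sum, hence lies in the domain, and is recovered from `(δ_τ^α - A) Y`; no
  -- closedness or convergence is involved.
  have hR := (resolvent_isResolventAt (hA.mem_resolventSet (cpow_mem_slitPlane h0 h1 hζ))).2 Y
  rw [← hYc]
  conv_rhs => rw [← hR, ← map_sub]
  congr 1
  have hcoef : ∀ n ∈ Finset.range (N + 1), ζ ^ n • c n =
      (ζ ^ n • ∑ j ∈ Finset.range (n + 1),
        ((((τ ^ α)⁻¹ : ℝ) : ℂ) * cqWeight k α j) • (w (n - j) : X)) - ζ ^ n • A (w n) := by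
    intro n hn
    rw [← hw n (Nat.lt_succ_iff.1 (Finset.mem_range.1 hn)), smul_sub, cqDeriv, Finset.smul_sum]
    simp only [smul_smul]
  rw [Finset.sum_congr rfl hcoef, Finset.sum_sub_distrib, ← hAY]
  abel

end Solution

/-! ### Resolvent estimate for nonpositive operators -/

section Dissipative

variable {H : Type*} [NormedAddCommGroup H] [InnerProductSpace ℂ H]

/-- In the right half plane adding `s ≥ 0` does not decrease the modulus; in the left one the
imaginary part, untouched by `s`, already suffices, as sine decreases on `[π/2, π]`. -/
theorem sin_mul_norm_mul_le_norm_mul_add {φ : ℝ} (hφ' : φ ≤ Real.pi) {z : ℂ}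
    (hz : |z.arg| ≤ φ) {a s : ℝ} (ha : 0 ≤ a) (hs : 0 ≤ s) :
    Real.sin φ * ‖z‖ * a ≤ ‖z * a + s‖ := by
  have hpi := Real.pi_pos
  have hna : ‖z * a‖ = ‖z‖ * a := by
    rw [norm_mul, Complex.norm_real, Real.norm_eq_abs, abs_of_nonneg ha]
  rcases le_or_gt |z.arg| (Real.pi / 2) with h | h
  · have hre := Complex.abs_arg_le_pi_div_two_iff.1 h
    calc Real.sin φ * ‖z‖ * a ≤ 1 * ‖z‖ * a := by
          gcongr
          exact Real.sin_le_one φ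
      _ = ‖z * a‖ := by rw [hna, one_mul]
      _ ≤ ‖z * a + s‖ := by
          refine le_of_sq_le_sq ?_ (norm_nonneg _)
          rw [Complex.sq_norm, Complex.sq_norm, Complex.normSq_apply, Complex.normSq_apply]
          simp
          nlinarith [mul_nonneg (mul_nonneg hre ha) hs]
  · calc Real.sin φ * ‖z‖ * a ≤ Real.sin |z.arg| * ‖z‖ * a := by
          gcongr
          rw [← Real.sin_pi_sub, ← Real.sin_pi_sub |z.arg|]
          exact Real.sin_le_sin_of_le_of_le_pi_div_two (by linarith) (by linarith) (by linarith)
      _ = |(z * a + s).im| := by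
          rw [← Real.abs_sin_eq_sin_abs_of_abs_le_pi (Complex.abs_arg_le_pi z), Complex.add_im,
            Complex.ofReal_im, add_zero, Complex.im_mul_ofReal, abs_mul, abs_of_nonneg ha,
            ← Complex.norm_mul_sin_arg z, abs_mul, abs_norm]
          ring
      _ ≤ ‖z * a + s‖ := Complex.abs_im_le_norm _

/-- `⟪y, A y⟫` is real and nonpositive for `y` in the domain of `A`. -/
def IsNonpositive (A : H →ₗ.[ℂ] H) : Prop :=
  ∀ y : A.domain, ∃ s : ℝ, 0 ≤ s ∧ ⟪(y : H), A y⟫_ℂ = -(s : ℂ)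

theorem IsNonpositive.le_norm {A : H →ₗ.[ℂ] H} (hA : IsNonpositive A) {φ : ℝ}
    (hφ' : φ ≤ Real.pi) {z : ℂ} (hz : |z.arg| ≤ φ) (y : A.domain) :
    Real.sin φ * ‖z‖ * ‖(y : H)‖ ≤ ‖z • (y : H) - A y‖ := by
  obtain ⟨s, hs, hy⟩ := hA y
  rcases (norm_nonneg (y : H)).eq_or_lt with h0 | h0
  · rw [← h0, mul_zero]
    exact norm_nonneg _
  · have h1 : ⟪(y : H), z • (y : H) - A y⟫_ℂ = z * ((‖(y : H)‖ ^ 2 : ℝ) : ℂ) + s := by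
      rw [inner_sub_right, inner_smul_right, inner_self_eq_norm_sq_to_K, hy, sub_neg_eq_add]
      push_cast
      rfl
    have h2 := sin_mul_norm_mul_le_norm_mul_add hφ' hz (sq_nonneg ‖(y : H)‖) hs
    rw [← h1] at h2
    have h3 := h2.trans (norm_inner_le_norm _ _)
    refine le_of_mul_le_mul_left ?_ h0
    linarith [h3]

theorem IsNonpositive.norm_resolvent_le {A : H →ₗ.[ℂ] H} (hA : IsNonpositive A) {φ : ℝ}
    (hφ : Real.pi / 2 ≤ φ) (hφ' : φ < Real.pi) {z : ℂ} (hz0 : z ≠ 0) (hz : |z.arg| ≤ φ)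
    {R : H →L[ℂ] H} (hR : IsResolventAt A z R) : ‖R‖ ≤ (Real.sin φ)⁻¹ * ‖z‖⁻¹ := by
  have hs : 0 < Real.sin φ := Real.sin_pos_of_pos_of_lt_pi (by linarith [Real.pi_pos]) hφ'
  have hz' : 0 < ‖z‖ := norm_pos_iff.2 hz0
  refine ContinuousLinearMap.opNorm_le_bound _ (by positivity) fun x => ?_
  obtain ⟨y, hy, hx⟩ := hR.1 x
  have h := hA.le_norm hφ'.le hz y
  rw [hx, hy] at h
  rw [← mul_inv, inv_mul_eq_div, le_div_iff₀ (by positivity)]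
  linarith

theorem IsNonpositive.one_mem_resolventSet {A : H →ₗ.[ℂ] H} (hA : IsNonpositive A)
    (hsurj : ∀ f : H, ∃ y : A.domain, (y : H) - A y = f) : (1 : ℂ) ∈ resolventSet A := by
  -- The sector bound with `φ = π/2`, so that the constant `sin φ` is 1.
  have hle : ∀ y : A.domain, ‖(y : H)‖ ≤ ‖(y : H) - A y‖ := fun y => by
    have := hA.le_norm (half_le_self Real.pi_pos.le) (z := 1)
      (by simp; positivity) y
    simpa using this
  let L : A.domain →ₗ[ℂ] H := A.domain.subtype - A.toFun
  have hL : ∀ y, L y = (y : H) - A y := fun y => rfl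
  have hinj : Function.Injective L := by
    rw [← LinearMap.ker_eq_bot, LinearMap.ker_eq_bot']
    intro y hy
    have h := hle y
    rw [← hL, hy, norm_zero] at h
    exact Subtype.ext (norm_le_zero_iff.1 h)
  let e := LinearEquiv.ofBijective L ⟨hinj, hsurj⟩
  have he : ∀ x, (e.symm x : H) - A (e.symm x) = x := fun x => by
    rw [← hL]
    exact e.apply_symm_apply x
  refine ⟨(A.domain.subtype ∘ₗ e.symm.toLinearMap).mkContinuous 1 fun x => ?_, fun x => ?_,
    fun y => ?_⟩
  · have := hle (e.symm x)
    rw [he] at this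
    simpa using this
  · refine ⟨e.symm x, rfl, ?_⟩
    rw [one_smul, he]
  · have : e.symm ((y : H) - A y) = y := e.symm_apply_apply y
    simp [this]

/-- Inside the slit plane the resolvent set is open by Neumann series. It is relatively closed
because near a limit point the a priori bound keeps the radius of the Neumann series from shrinking.
It contains 1, so connectedness gives everything. -/
theorem IsNonpositive.resolventEstimate [CompleteSpace H] {A : H →ₗ.[ℂ] H} (hA : IsNonpositive A)
    (hsurj : ∀ f : H, ∃ y : A.domain, (y : H) - A y = f) : ResolventEstimate A := by
  have hpi := Real.pi_pos
  have hunit : ∀ {z₀ z : ℂ} {R : H →L[ℂ] H}, ‖z - z₀‖ * ‖R‖ < 1 →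
      IsUnit (1 + (z - z₀) • R) := by
    intro z₀ z R h
    have := isUnit_one_sub_of_norm_lt_one (x := -((z - z₀) • R)) (by rwa [norm_neg, norm_smul])
    rwa [sub_neg_eq_add] at this
  have hopen : IsOpen (resolventSet A) := by
    rw [isOpen_iff_mem_nhds]
    rintro z₀ ⟨R, hR⟩
    have hc : ContinuousAt (fun z : ℂ => ‖z - z₀‖ * ‖R‖) z₀ := by fun_prop
    filter_upwards [hc.eventually_lt continuousAt_const (by simp : ‖z₀ - z₀‖ * ‖R‖ < 1)] with z hz
    exact ⟨_, hR.mul_inverse (hunit hz)⟩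
  have hsub : Complex.slitPlane ⊆ resolventSet A ∩ Complex.slitPlane := by
    have hconn : IsPreconnected Complex.slitPlane :=
      (Complex.starConvex_one_slitPlane.isPathConnected
        Complex.one_mem_slitPlane).isConnected.isPreconnected
    refine hconn.subset_of_closure_inter_subset (hopen.inter Complex.isOpen_slitPlane)
      ⟨1, ⟨Complex.one_mem_slitPlane, hA.one_mem_resolventSet hsurj,
        Complex.one_mem_slitPlane⟩⟩ ?_
    rintro z ⟨hzc, hz⟩
    refine ⟨?_, hz⟩
    obtain ⟨harg, h0⟩ := Complex.mem_slitPlane_iff_arg.1 hz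
    have hlt : |z.arg| < Real.pi := by
      refine lt_of_le_of_ne (Complex.abs_arg_le_pi z) fun h => ?_
      rcases (abs_eq hpi.le).1 h with h | h
      · exact harg h
      · exact (Complex.neg_pi_lt_arg z).ne' h
    obtain ⟨φ, h1, h2⟩ := exists_between (max_lt (half_lt_self hpi) hlt)
    have hφ : Real.pi / 2 < φ := (le_max_left _ _).trans_lt h1
    have hs : 0 < Real.sin φ := Real.sin_pos_of_pos_of_lt_pi (by linarith) h2
    have hz0 : 0 < ‖z‖ := norm_pos_iff.2 h0
    have hargc : ∀ᶠ w in 𝓝 z, |w.arg| < φ :=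
      (Complex.continuousAt_arg hz).abs.eventually_lt continuousAt_const
        ((le_max_right _ _).trans_lt h1)
    have hbd : ∀ᶠ w in 𝓝 z, ‖z - w‖ * ((Real.sin φ)⁻¹ * ‖w‖⁻¹) < 1 := by
      have hc : ContinuousAt (fun w : ℂ => ‖z - w‖ * ((Real.sin φ)⁻¹ * ‖w‖⁻¹)) z := by
        have h3 : ContinuousAt (fun w : ℂ => ‖w‖⁻¹) z := continuous_norm.continuousAt.inv₀ hz0.ne'
        exact ContinuousAt.mul (by fun_prop) (continuousAt_const.mul h3)
      exact hc.eventually_lt continuousAt_const (by simp)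
    obtain ⟨w, ⟨⟨R, hR⟩, hw⟩, hw1, hw2⟩ :=
      ((mem_closure_iff_frequently.1 hzc).and_eventually (hargc.and hbd)).exists
    have hRn := hA.norm_resolvent_le hφ.le h2 (Complex.slitPlane_ne_zero hw) hw1.le hR
    refine ⟨_, hR.mul_inverse (hunit (lt_of_le_of_lt ?_ hw2))⟩
    gcongr
  intro φ hφ hφ'
  refine ⟨(Real.sin φ)⁻¹, fun z hz0 hz => ?_⟩
  have hmem : z ∈ resolventSet A := by
    refine (hsub (Complex.mem_slitPlane_iff_arg.2 ⟨fun h => ?_, hz0⟩)).1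
    rw [h, abs_of_pos hpi] at hz
    linarith
  exact ⟨hmem, hA.norm_resolvent_le hφ.le hφ' hz0 hz.le (resolvent_isResolventAt hmem)⟩

end Dissipative

/-! ### The Dirichlet and Galerkin Laplacians -/

section Laplacian

variable {d : ℕ} {Ω : Set (EuclideanSpace ℝ (Fin d))}

/-- Riesz representation of `χ ↦ ⟪f, χ⟫` in the `H¹` inner product on `V ∩ H¹₀(Ω)`. It solves `u -
Δu = f` for both operators: `V = ⊤` is the continuous case. -/
theorem exists_isWeakLaplacian (V : Submodule ℂ (L2 Ω)) (hV : IsClosed (V : Set (L2 Ω)))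
    (f : L2 Ω) : ∃ u ∈ V, IsWeakLaplacian Ω V u (u - f) := by
  -- The plain product carries the sup norm; its Euclidean version makes the graph of the gradient a
  -- Hilbert space.
  let K := WithLp 2 (L2 Ω × PiLp 2 fun _ : Fin d => L2 Ω)
  let T : K →L[ℂ] L2 Ω × (Fin d → L2 Ω) :=
    (WithLp.fstL 2 ℂ (L2 Ω) (PiLp 2 fun _ : Fin d => L2 Ω)).prod
      ((PiLp.continuousLinearEquiv 2 ℂ fun _ : Fin d => L2 Ω).toContinuousLinearMap.comp
        (WithLp.sndL 2 ℂ (L2 Ω) (PiLp 2 fun _ : Fin d => L2 Ω)))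
  let M : Submodule ℂ K := (sobolevGraph Ω ⊓ V.comap (LinearMap.fst ℂ _ _)).comap T.toLinearMap
  have hM : IsClosed (M : Set K) := by
    have h1 : IsClosed (sobolevGraph Ω : Set (L2 Ω × (Fin d → L2 Ω))) :=
      Submodule.isClosed_topologicalClosure _
    exact (h1.inter (hV.preimage continuous_fst)).preimage T.continuous
  have : CompleteSpace M := hM.completeSpace_coe
  let g : M →L[ℂ] ℂ := (innerSL ℂ f).comp
    ((WithLp.fstL 2 ℂ (L2 Ω) (PiLp 2 fun _ : Fin d => L2 Ω)).comp M.subtypeL)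
  set m : M := (InnerProductSpace.toDual ℂ M).symm g with hm
  have hmem : T m ∈ sobolevGraph Ω ⊓ V.comap (LinearMap.fst ℂ _ _) := m.2
  refine ⟨(T m).1, hmem.2, (T m).2, hmem.1, fun χ q hχ hq => ?_⟩
  let x : M := ⟨WithLp.toLp 2 (χ, WithLp.toLp 2 q), ⟨hq, hχ⟩⟩
  have h1 : ⟪m, x⟫_ℂ = ⟪f, χ⟫_ℂ := InnerProductSpace.toDual_symm_apply
  have h2 : ⟪m, x⟫_ℂ = ⟪(T m).1, χ⟫_ℂ + ∑ i, ⟪(T m).2 i, q i⟫_ℂ := by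
    rw [Submodule.coe_inner, WithLp.prod_inner_apply, PiLp.inner_apply]
    rfl
  have h3 := congrArg (starRingEnd ℂ) (h2.symm.trans h1)
  rw [map_add, map_sum] at h3
  simp only [inner_conj_symm] at h3
  rw [inner_sub_right, ← h3]
  ring

theorem IsWeakLaplacian.exists_inner_eq {V : Submodule ℂ (L2 Ω)} {u w : L2 Ω}
    (h : IsWeakLaplacian Ω V u w) (hu : u ∈ V) : ∃ s : ℝ, 0 ≤ s ∧ ⟪u, w⟫_ℂ = -(s : ℂ) := by
  obtain ⟨p, hp, hpw⟩ := h
  refine ⟨∑ i, ‖p i‖ ^ 2, by positivity, ?_⟩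
  rw [← neg_eq_iff_eq_neg, ← hpw u p hu hp]
  push_cast
  exact Finset.sum_congr rfl fun i _ => inner_self_eq_norm_sq_to_K (𝕜 := ℂ) (p i)

theorem resolventEstimate_dirichletLaplacian (hΩ : IsOpen Ω) :
    ResolventEstimate (dirichletLaplacian Ω) := by
  refine IsNonpositive.resolventEstimate (fun y => ?_) fun f => ?_
  · exact ((mem_graph_dirichletLaplacian hΩ _ _).1
      (LinearPMap.mem_graph _ y)).exists_inner_eq trivial
  · obtain ⟨u, -, hu⟩ := exists_isWeakLaplacian (Ω := Ω) ⊤ isClosed_univ f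
    obtain ⟨y, hy, hAy⟩ := (LinearPMap.mem_graph_iff _).1
      ((mem_graph_dirichletLaplacian hΩ _ _).2 hu)
    refine ⟨y, ?_⟩
    rw [hy, hAy, sub_sub_cancel]

theorem resolventEstimate_galerkinLaplacian (V : Submodule ℂ (L2 Ω)) [FiniteDimensional ℂ V]
    (hV : ∀ u ∈ V, ∃ p : Fin d → L2 Ω, (u, p) ∈ sobolevGraph Ω) :
    ResolventEstimate (galerkinLaplacian Ω V) := by
  have : CompleteSpace V := FiniteDimensional.complete ℂ V
  refine IsNonpositive.resolventEstimate (fun y => ?_) fun f => ?_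
  · exact ((mem_graph_galerkinLaplacian hV _ _).1
      (LinearPMap.mem_graph _ y)).exists_inner_eq (y : V).2
  · obtain ⟨u, huV, hu⟩ := exists_isWeakLaplacian V V.closed_of_finiteDimensional f
    obtain ⟨y, hy, hAy⟩ := (LinearPMap.mem_graph_iff _).1
      ((mem_graph_galerkinLaplacian hV ⟨u, huV⟩ (⟨u, huV⟩ - f)).2 hu)
    refine ⟨y, ?_⟩
    rw [hy, hAy, sub_sub_cancel]

end Laplacian

/-! ### Generating functions of the corrected source -/

section Source

variable {X : Type*} [NormedAddCommGroup X] [NormedSpace ℂ X]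

theorem analyticAt_clm_apply {L : ℂ → X →L[ℂ] X} {F : ℂ → X} {ζ : ℂ} (hL : AnalyticAt ℂ L ζ)
    (hF : AnalyticAt ℂ F ζ) : AnalyticAt ℂ (fun ζ => L ζ (F ζ)) ζ :=
  ((ContinuousLinearMap.id ℂ (X →L[ℂ] X)).analyticAt_bilinear (L ζ, F ζ)).comp₂ hL hF

/-- `ζ/(1-ζ) + ∑_{j=1}^{k-1} a_j ζ^j`. -/
noncomputable def startFn (k : ℕ) (a : ℕ → ℂ) (ζ : ℂ) : ℂ :=
  ζ / (1 - ζ) + ∑ j ∈ Finset.Icc 1 (k - 1), a j * ζ ^ j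

/-- `∑_ℓ (γ_ℓ/ℓ! + ∑_j b_{ℓ,j} ζ^j) τ^ℓ y_ℓ`. -/
noncomputable def sourceFn (k : ℕ) (τ : ℝ) (b : ℕ → ℕ → ℂ) (y : ℕ → X) (ζ : ℂ) : X :=
  ∑ ℓ ∈ Finset.Icc 1 (k - 2), ((gammaFn ℓ ζ / (ℓ.factorial : ℂ) +
    ∑ j ∈ Finset.Icc 1 (k - 1), b ℓ j * ζ ^ j) * (τ : ℂ) ^ ℓ) • y ℓ

theorem analyticAt_startFn (k : ℕ) (a : ℕ → ℂ) {ζ : ℂ} (hζ : ζ ≠ 1) :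
    AnalyticAt ℂ (startFn k a) ζ :=
  (analyticAt_id.div (analyticAt_const.sub analyticAt_id) (sub_ne_zero.2 hζ.symm)).add
    (Finset.analyticAt_fun_sum _ fun j _ => analyticAt_const.mul (analyticAt_id.pow j))

theorem analyticAt_sourceFn (k : ℕ) (τ : ℝ) (b : ℕ → ℕ → ℂ) (y : ℕ → X) {ζ : ℂ} (hζ : ζ ≠ 1) :
    AnalyticAt ℂ (sourceFn k τ b y) ζ :=
  Finset.analyticAt_fun_sum _ fun ℓ _ => ((((analyticAt_gammaFn ℓ hζ).div_const).add
    (Finset.analyticAt_fun_sum _ fun j _ => analyticAt_const.mul (analyticAt_id.pow j))).mul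
      analyticAt_const).smul analyticAt_const

theorem isTaylor_startFn (k : ℕ) (a : ℕ → ℂ) : IsTaylor (startFn k a) fun n =>
    ((if n = 0 then 0 else 1) + if n ∈ Finset.Icc 1 (k - 1) then a n else 0) := by
  -- This is `ζ/(1-ζ) = γ_0(ζ) - 1`.
  have h := ((isTaylor_gammaFn 0).add ((isTaylor_pow 0).const_smul (-1))).add
    (isTaylor_sum_pow (Finset.Icc 1 (k - 1)) a)
  intro M
  refine (h M).congr' ?_ EventuallyEq.rfl
  filter_upwards [isOpen_ne.mem_nhds (zero_ne_one : (0 : ℂ) ≠ 1)] with ζ hζ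
  have h1 : (1 - ζ) ≠ 0 := sub_ne_zero.2 (Ne.symm hζ)
  congr 1
  · simp only [gammaFn, startFn, pow_zero, smul_eq_mul]
    congr 1
    field_simp
    ring
  · refine Finset.sum_congr rfl fun n _ => ?_
    congr 2
    split_ifs <;> simp

theorem isTaylor_sourceFn (k : ℕ) (τ : ℝ) (b : ℕ → ℕ → ℂ) (y : ℕ → X) :
    IsTaylor (sourceFn k τ b y) fun n => ∑ ℓ ∈ Finset.Icc 1 (k - 2),
      (((n : ℂ) ^ ℓ / (ℓ.factorial : ℂ) + if n ∈ Finset.Icc 1 (k - 1) then b ℓ n else 0) *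
        (τ : ℂ) ^ ℓ) • y ℓ := by
  refine IsTaylor.sum _ fun ℓ _ => IsTaylor.smul_const ?_ _
  have h := (((isTaylor_gammaFn ℓ).const_smul ((ℓ.factorial : ℂ)⁻¹)).add
    (isTaylor_sum_pow (Finset.Icc 1 (k - 1)) (b ℓ))).const_smul ((τ : ℂ) ^ ℓ)
  simp only [smul_eq_mul] at h
  intro M
  refine (h M).congr_left fun ζ => ?_
  simp only [smul_eq_mul, div_eq_inv_mul, mul_comm _ ((τ : ℂ) ^ ℓ)]

theorem IsGeneratingFunction.isTaylor {r : ℕ → X} {D : Set ℂ} {R : ℂ → X}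
    (h : IsGeneratingFunction r D R) : IsTaylor R fun n => if n = 0 then 0 else r n := by
  refine isTaylor_of_hasSum ?_
  filter_upwards [h.hasSum] with ζ hζ
  rw [← hasSum_nat_add_iff' 1]
  simpa using hζ

/-- The scheme for `W = U - v` in one formula for all `n ≤ N`, with the right-hand side arranged as
Taylor coefficients: `AU^n = AW^n + Av` brings in `Av`, and expanding `f(t_n)` at 0 produces the
coefficients `n^ℓ` of `γ_ℓ`. -/
theorem IsDiscreteSolution.cqDeriv_sub {k : ℕ} {α τ T : ℝ} {N : ℕ} {A : X →ₗ.[ℂ] X} {a : ℕ → ℂ}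
    {b : ℕ → ℕ → ℂ} {v : A.domain} {f : ℝ → X} {U : ℕ → A.domain}
    (hU : IsDiscreteSolution k α τ T N A a b v f U) {r : ℕ → X}
    (hr : ∀ n : ℕ, 1 ≤ n → n ≤ N → r n = remainder k T f (n * τ)) {n : ℕ} (hn : n ≤ N) :
    cqDeriv k α τ (fun m => ((U m - v : A.domain) : X)) n - A (U n - v) =
      ((if n = 0 then 0 else 1) + if n ∈ Finset.Icc 1 (k - 1) then a n else 0 : ℂ) • (A v + f 0) +
        (∑ ℓ ∈ Finset.Icc 1 (k - 2), (((n : ℂ) ^ ℓ / (ℓ.factorial : ℂ) +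
          if n ∈ Finset.Icc 1 (k - 1) then b ℓ n else 0) * (τ : ℂ) ^ ℓ) • derivAtZero T f ℓ) +
        if n = 0 then 0 else r n := by
  -- The scheme says nothing at `n = 0`; there both sides vanish, since `W^0 = 0` and every `ℓ ≥ 1`.
  rcases Nat.eq_zero_or_pos n with rfl | hn1
  · have h0 : ∀ ℓ ∈ Finset.Icc 1 (k - 2), ((((0 : ℕ) : ℂ) ^ ℓ / (ℓ.factorial : ℂ) +
        if 0 ∈ Finset.Icc 1 (k - 1) then b ℓ 0 else 0) * (τ : ℂ) ^ ℓ) • derivAtZero T f ℓ = 0 := by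
      intro ℓ hℓ
      have : ℓ ≠ 0 := by have := (Finset.mem_Icc.1 hℓ).1; omega
      simp [this]
    rw [Finset.sum_eq_zero h0]
    simp [cqDeriv, hU.init]
  · have hf : f (n * τ) = f 0 + (∑ ℓ ∈ Finset.Icc 1 (k - 2),
        ((n : ℂ) ^ ℓ / (ℓ.factorial : ℂ) * (τ : ℂ) ^ ℓ) • derivAtZero T f ℓ) + r n := by
      have hs : ∀ ℓ ∈ Finset.Icc 1 (k - 2),
          ((n : ℂ) ^ ℓ / (ℓ.factorial : ℂ) * (τ : ℂ) ^ ℓ) • derivAtZero T f ℓ =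
          ((n * τ) ^ ℓ / (ℓ.factorial : ℝ)) • derivAtZero T f ℓ := by
        intro ℓ _
        rw [← Complex.coe_smul]
        congr 1
        push_cast
        ring
      rw [hr n hn1 hn, remainder, Finset.sum_congr rfl hs]
      abel
    rw [if_neg hn1.ne', if_neg hn1.ne', LinearPMap.map_sub]
    simp only [AddSubgroupClass.coe_sub]
    rcases lt_or_ge n k with hk | hk
    · have hmem : n ∈ Finset.Icc 1 (k - 1) := Finset.mem_Icc.2 ⟨hn1, by omega⟩
      have h := hU.corrected n hn1 hn hk
      simp only [if_pos hmem, add_mul, add_smul, Finset.sum_add_distrib]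
      rw [sub_sub_eq_add_sub, add_sub_right_comm, h, hf]
      simp only [one_smul]
      abel
    · have hmem : n ∉ Finset.Icc 1 (k - 1) := fun h => by
        have := (Finset.mem_Icc.1 h).2
        omega
      have h := hU.standard n hn1 hn hk
      simp only [if_neg hmem, add_zero]
      rw [sub_sub_eq_add_sub, add_sub_right_comm, h, hf, one_smul]
      abel

end Source

end BDFSub

/-! ### Assembly of the representation -/

open BDFSub in
theorem theorem2p1 :
    (∀ k : ℕ, 1 ≤ k → k ≤ 6 → ∃ θ₀ : ℝ, Real.pi / 2 < θ₀ ∧ θ₀ ≤ Real.pi ∧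
      ∀ (α : ℝ), 0 < α → α < 1 →
      ∀ (X : Type u) [NormedAddCommGroup X] [NormedSpace ℂ X] [CompleteSpace X]
        (A : X →ₗ.[ℂ] X), ResolventEstimate A →
      ∀ (T τ : ℝ) (N : ℕ), 0 < T → 1 ≤ N → τ = T / N →
      ∀ (a : ℕ → ℂ) (b : ℕ → ℕ → ℂ) (v : A.domain) (f : ℝ → X),
        ContDiffWithinAt ℝ (k - 2 : ℕ) f (Set.Icc 0 T) 0 →
      ∀ (U : ℕ → A.domain), IsDiscreteSolution k α τ T N A a b v f U →
      ∀ (θ δ : ℝ), Real.pi / 2 < θ → θ < θ₀ → 0 < δ → δ < Real.pi / τ →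
      ∀ (r : ℕ → X) (R : ℂ → X), (∀ n : ℕ, 1 ≤ n → n ≤ N → r n = remainder k T f (n * τ)) →
        IsGeneratingFunction r (zetaRegion θ δ τ) R →
      (∀ z ∈ contour θ δ τ,
        bdfStep k τ (Complex.exp (-(z * τ))) ∈ Complex.slitPlane ∧
        bdfStep k τ (Complex.exp (-(z * τ))) ^ (α : ℂ) ∈ BDFSub.resolventSet A) ∧
      ContinuousOn (fun z : ℂ => kernel A α (bdfStep k τ (Complex.exp (-(z * τ)))))
        (contour θ δ τ) ∧
      ∀ n : ℕ, 1 ≤ n → n ≤ N →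
        (U n : X) - v =
          (1 / (2 * Real.pi * Complex.I)) • contourIntegral θ δ τ (fun z : ℂ =>
            Complex.exp (z * (n * τ)) • muFn k a (Complex.exp (-(z * τ))) •
              kernel A α (bdfStep k τ (Complex.exp (-(z * τ)))) (A v + f 0)) +
          (1 / (2 * Real.pi * Complex.I)) • contourIntegral θ δ τ (fun z : ℂ =>
            Complex.exp (z * (n * τ)) • bdfStep k τ (Complex.exp (-(z * τ))) •
              kernel A α (bdfStep k τ (Complex.exp (-(z * τ))))
                (∑ ℓ ∈ Finset.Icc 1 (k - 2),
                  ((gammaFn ℓ (Complex.exp (-(z * τ))) / (ℓ.factorial : ℂ) +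
                    ∑ j ∈ Finset.Icc 1 (k - 1), b ℓ j * Complex.exp (-(z * (j * τ)))) *
                      (τ : ℂ) ^ (ℓ + 1)) • derivAtZero T f ℓ)) +
          (1 / (2 * Real.pi * Complex.I)) • contourIntegral θ δ τ (fun z : ℂ =>
            Complex.exp (z * (n * τ)) • bdfStep k τ (Complex.exp (-(z * τ))) •
              kernel A α (bdfStep k τ (Complex.exp (-(z * τ))))
                ((τ : ℂ) • R (Complex.exp (-(z * τ)))))) ∧
    (∀ (d : ℕ) (Ω : Set (EuclideanSpace ℝ (Fin d))), IsOpen Ω →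
      ResolventEstimate (dirichletLaplacian Ω) ∧
      ∀ V : Submodule ℂ (L2 Ω), FiniteDimensional ℂ V →
        (∀ u ∈ V, ∃ p : Fin d → L2 Ω, (u, p) ∈ sobolevGraph Ω) →
        ResolventEstimate (galerkinLaplacian Ω V)) := by
  refine ⟨fun k hk hk6 => ?_, fun d Ω hΩ => ⟨resolventEstimate_dirichletLaplacian hΩ,
    fun V _ hV => resolventEstimate_galerkinLaplacian V hV⟩⟩
  obtain ⟨θ₀, hθ₀, hθ₀', hangle⟩ := exists_angle_bdfStep_mem_slitPlane hk hk6
  refine ⟨θ₀, hθ₀, hθ₀', ?_⟩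
  intro α h0 h1 X _ _ _ A hA T τ N hT hN hτT a b v f _ U hU θ δ hθ hθθ₀ hδ hδP r R hr hR
  have hpi := Real.pi_pos
  have hτ : 0 < τ := by
    rw [hτT]
    have : (0 : ℝ) < N := by exact_mod_cast hN
    positivity
  have hτ0 : (τ : ℂ) ≠ 0 := by exact_mod_cast hτ.ne'
  have hθ0 : 0 < θ := by linarith
  have hθ' : θ < Real.pi := hθθ₀.trans_le hθ₀'
  have hslit : ∀ z ∈ sectorStrip θ δ (Real.pi / τ),
      bdfStep k τ (Complex.exp (-(z * τ))) ∈ Complex.slitPlane := fun z hz =>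
    hangle θ hθθ₀ τ hτ z (norm_pos_iff.1 (hδ.trans_le hz.1)) hz.2.1 hz.2.2
  -- The pole at `ζ = 1` of the data is avoided because `δ(1) = 0` is outside the slit plane.
  have hne1 : ∀ z ∈ sectorStrip θ δ (Real.pi / τ), Complex.exp (-(z * τ)) ≠ 1 := by
    intro z hz h
    refine Complex.slitPlane_ne_zero (hslit z hz) ?_
    rw [h, bdfStep, bdf_one, mul_zero]
  have hsub := contour_subset_sectorStrip (τ := τ) hδ hθ0 hθ'
  have hexpc : Continuous fun z : ℂ => Complex.exp (-(z * τ)) := by fun_prop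
  have hresc : ContinuousOn (fun z : ℂ =>
      resolvent A (bdfStep k τ (Complex.exp (-(z * τ))) ^ (α : ℂ)))
      (sectorStrip θ δ (Real.pi / τ)) := fun z hz =>
    (ContinuousAt.comp (f := fun z : ℂ => Complex.exp (-(z * τ)))
      (analyticAt_resolvent_bdfStep hA h0 h1 (hslit z hz)).continuousAt
      hexpc.continuousAt).continuousWithinAt
  refine ⟨fun z hz => ⟨hslit z (hsub hz),
    hA.mem_resolventSet (cpow_mem_slitPlane h0 h1 (hslit z (hsub hz)))⟩, ?_, fun n hn1 hn => ?_⟩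
  · have hc : Continuous fun z : ℂ => bdfStep k τ (Complex.exp (-(z * τ))) :=
      ((differentiable_bdf k).const_mul (1 / (τ : ℂ))).continuous.comp hexpc
    exact (hc.continuousOn.inv₀ fun z hz => Complex.slitPlane_ne_zero (hslit z (hsub hz))).smul
      (hresc.mono hsub)
  · set F₁ : ℂ → X := fun ζ => startFn k a ζ • (A v + f 0) with hF₁
    set F₂ : ℂ → X := sourceFn k τ b (derivAtZero T f) with hF₂
    have hF₁a : ∀ z ∈ sectorStrip θ δ (Real.pi / τ), AnalyticAt ℂ F₁ (Complex.exp (-(z * τ))) :=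
      fun z hz => (analyticAt_startFn k a (hne1 z hz)).smul analyticAt_const
    have hF₂a : ∀ z ∈ sectorStrip θ δ (Real.pi / τ), AnalyticAt ℂ F₂ (Complex.exp (-(z * τ))) :=
      fun z hz => analyticAt_sourceFn k τ b _ (hne1 z hz)
    have hRa : ∀ z ∈ sectorStrip θ δ (Real.pi / τ), AnalyticAt ℂ R (Complex.exp (-(z * τ))) :=
      fun z hz => hR.analytic _ (Or.inr ⟨z, hz.1, hz.2.1, hz.2.2, rfl⟩)
    have hres : ∀ z ∈ sectorStrip θ δ (Real.pi / τ), AnalyticAt ℂ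
        (fun ζ => resolvent A (bdfStep k τ ζ ^ (α : ℂ))) (Complex.exp (-(z * τ))) :=
      fun z hz => analyticAt_resolvent_bdfStep hA h0 h1 (hslit z hz)
    set g : (ℂ → X) → ℂ → X := fun F z => Complex.exp (z * (n * τ)) •
      resolvent A (bdfStep k τ (Complex.exp (-(z * τ))) ^ (α : ℂ)) (F (Complex.exp (-(z * τ))))
      with hg
    have hgc : ∀ F : ℂ → X, (∀ z ∈ sectorStrip θ δ (Real.pi / τ),
        AnalyticAt ℂ F (Complex.exp (-(z * τ)))) →
        ContinuousOn (g F) (sectorStrip θ δ (Real.pi / τ)) := by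
      intro F hF
      refine ContinuousOn.smul (Continuous.continuousOn (by fun_prop)) (hresc.clm_apply ?_)
      exact fun z hz => (ContinuousAt.comp (f := fun z : ℂ => Complex.exp (-(z * τ)))
        (hF z hz).continuousAt hexpc.continuousAt).continuousWithinAt
    -- Here `δ = τ δ_τ`, and `δ_τ` cancels the inverse in `K`, leaving the bare resolvent with a
    -- factor `τ`.
    have e1 : EqOn (fun z : ℂ =>
            Complex.exp (z * (n * τ)) • muFn k a (Complex.exp (-(z * τ))) •
              kernel A α (bdfStep k τ (Complex.exp (-(z * τ)))) (A v + f 0))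
        (fun z => (τ : ℂ) • g F₁ z) (sectorStrip θ δ (Real.pi / τ)) := by
      intro z hz
      have hb : bdf k (Complex.exp (-(z * τ))) = τ * bdfStep k τ (Complex.exp (-(z * τ))) := by
        rw [bdfStep]; field_simp
      have hb0 := Complex.slitPlane_ne_zero (hslit z hz)
      simp only [hg, hF₁, muFn, kernel, hb, map_smul, smul_smul,
        _root_.smul_apply]
      congr 1
      rw [startFn]
      field_simp
    have e2 : EqOn (fun z : ℂ =>
            Complex.exp (z * (n * τ)) • bdfStep k τ (Complex.exp (-(z * τ))) •
              kernel A α (bdfStep k τ (Complex.exp (-(z * τ))))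
                (∑ ℓ ∈ Finset.Icc 1 (k - 2),
                  ((gammaFn ℓ (Complex.exp (-(z * τ))) / (ℓ.factorial : ℂ) +
                    ∑ j ∈ Finset.Icc 1 (k - 1), b ℓ j * Complex.exp (-(z * (j * τ)))) *
                      (τ : ℂ) ^ (ℓ + 1)) • derivAtZero T f ℓ))
        (fun z => (τ : ℂ) • g F₂ z) (sectorStrip θ δ (Real.pi / τ)) := by
      intro z hz
      have hb0 := Complex.slitPlane_ne_zero (hslit z hz)
      have hpow : ∀ j : ℕ, Complex.exp (-(z * (j * τ))) = Complex.exp (-(z * τ)) ^ j := by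
        intro j
        rw [← Complex.exp_nat_mul]
        congr 1
        ring
      have hsum : (∑ ℓ ∈ Finset.Icc 1 (k - 2),
          ((gammaFn ℓ (Complex.exp (-(z * τ))) / (ℓ.factorial : ℂ) +
            ∑ j ∈ Finset.Icc 1 (k - 1), b ℓ j * Complex.exp (-(z * (j * τ)))) *
              (τ : ℂ) ^ (ℓ + 1)) • derivAtZero T f ℓ) = (τ : ℂ) • F₂ (Complex.exp (-(z * τ))) := by
        rw [hF₂, sourceFn, Finset.smul_sum]
        refine Finset.sum_congr rfl fun ℓ _ => ?_
        simp only [hpow, smul_smul]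
        congr 1
        ring
      simp only [hsum, hg, kernel, map_smul, smul_smul, _root_.smul_apply]
      congr 1
      field_simp
    have e3 : EqOn (fun z : ℂ =>
            Complex.exp (z * (n * τ)) • bdfStep k τ (Complex.exp (-(z * τ))) •
              kernel A α (bdfStep k τ (Complex.exp (-(z * τ))))
                ((τ : ℂ) • R (Complex.exp (-(z * τ)))))
        (fun z => (τ : ℂ) • g R z) (sectorStrip θ δ (Real.pi / τ)) := by
      intro z hz
      have hb0 := Complex.slitPlane_ne_zero (hslit z hz)
      simp only [hg, kernel, map_smul, smul_smul, _root_.smul_apply]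
      congr 1
      field_simp
    have hO := isBigO_resolvent_sub hA hk h0 h1 hτ
      (((isTaylor_startFn k a).smul_const (A v + f 0)).add
        (isTaylor_sourceFn k τ b (derivAtZero T f)) |>.add hR.isTaylor)
      (w := fun m => U m - v) (N := N) fun m hm => hU.cqDeriv_sub hr hm
    have hmain := contourIntegral_exp_smul hτ hδ hδP hθ hθ'
      (fun z hz => analyticAt_clm_apply (hres z hz)
        (((hF₁a z hz).add (hF₂a z hz)).add (hRa z hz))) hO hn
    have hsplit : contourIntegral θ δ τ (g F₁) + contourIntegral θ δ τ (g F₂) +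
        contourIntegral θ δ τ (g R) = (2 * Real.pi * Complex.I / τ : ℂ) • ((U n : X) - v) := by
      have hadd := contourIntegral_add hδ hδP hθ0 hθ' (hgc F₁ hF₁a) (hgc F₂ hF₂a)
      rw [← hadd, ← contourIntegral_add (f := fun z => g F₁ z + g F₂ z) hδ hδP hθ0 hθ'
        ((hgc F₁ hF₁a).add (hgc F₂ hF₂a)) (hgc R hRa), ← AddSubgroupClass.coe_sub, ← hmain]
      congr 1
      funext z
      simp only [hg, Pi.add_apply, map_add, smul_add]
    rw [contourIntegral_congr hδ hδP hθ0 hθ' e1, contourIntegral_congr hδ hδP hθ0 hθ' e2,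
      contourIntegral_congr hδ hδP hθ0 hθ' e3, contourIntegral_smul, contourIntegral_smul,
      contourIntegral_smul, ← smul_add, ← smul_add, ← smul_add, ← smul_add, hsplit, smul_smul,
      smul_smul]
    have hpi0 : (Real.pi : ℂ) ≠ 0 := by exact_mod_cast hpi.ne'
    -- The factor `τ` of all three integrands compensates the period `2πi/τ` from coefficient
    -- extraction.
    have hc : 1 / (2 * Real.pi * Complex.I) * τ * (2 * Real.pi * Complex.I / τ) = 1 := by
      field_simp [Complex.I_ne_zero]
    rw [hc, one_smul]
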